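/- Let $p,q:[0,\infty)\to\mathbb R$ be continuously differentiable and put $$J=\begin{bmatrix}0&1\\-1&0\end{bmatrix},\quad \mathcal V=\begin{bmatrix}p&q\\q&-p\end{bmatrix},\quad j=\begin{bmatrix}1&0\\0&-1\end{bmatrix},\quad v=\mathrm i q-p,\quad V=\begin{bmatrix}0&v\\ \overline v&0\end{bmatrix},\quad \Theta=\frac1{\sqrt2}\begin{bmatrix}1&-1\\1&1\end{bmatrix}.$$ Assume that $\sup_{x>0}\|\mathcal V(x)\|<M_1$ (operator norm), and set $M=2\sqrt2\,M_1$, $\mathbb C_M=\{z\in\mathbb C:\Im z>M\}$, $\mathbb C_+=\{z\in\mathbb C:\Im z>0\}$. Let $r$ be the response function of the dynamical Dirac system $$\mathrm i Y_t+JY_x+\mathcal V Y=0\quad(x>0,\ t>0),\qquad Y(x,0)=0\ (x\ge0),\quad Y_1(0,t)=f(t)\ (t\ge0),$$ that is, $r$ is the continuous function on $[0,\infty)$ such that for all controls $f$ (continuously differentiable $f:\mathbb R\to\mathbb C$ with $f(t)=0$ for $t\le0$, bounded together with $f'$) the classical solution $Y=\begin{bmatrix}Y_1\\Y_2\end{bmatrix}$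 satisfies $$Y_2(0,t)=\mathrm i f(t)+\int_0^t r(t-s)f(s)\,ds\qquad(t\ge0).$$ Let $u(x,z)$ be the solution of the corresponding spectral Dirac system $\frac{d}{dx}u=\mathrm i(zj+jV(x))u$ on $[0,\infty)$ with $u(0,z)=I_2$. A Weyl function of this system is a holomorphic function $\varphi$ on $\mathbb C_+$ with $$\int_0^\infty\begin{bmatrix}1&\overline{\varphi(z)}\end{bmatrix}u(x,z)^*u(x,z)\begin{bmatrix}1\\ \varphi(z)\end{bmatrix}dx<\infty\qquad(z\in\mathbb C_+),$$ and a Herglotz-type Weyl function is a holomorphic function $\varphi_H$ on $\mathbb C_+$ with $$\int_0^\infty\begin{bmatrix}1&\mathrm i\,\overline{\varphi_H(z)}\end{bmatrix}\Theta\, u(x,z)^*u(x,z)\,\Theta^*\begin{bmatrix}1\\ -\mathrm i\varphi_H(z)\end{bmatrix}dx<\infty\qquad(z\in\mathbb C_+).$$ Then for every $z\in\mathbb C_M$ the integral $\widehat r(z)=\int_0^\infty \mathrm e^{\mathrm i zt}r(t)\,dt$ converges absolutely, $\widehat r(z)+2\mathrm i\ne0$, and the Weyl function $\varphi$ and the Herglotz-type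 Weyl function $\varphi_H$ of the system satisfy $$\varphi(z)=\frac{\widehat r(z)}{\widehat r(z)+2\mathrm i},\qquad \varphi_H(z)=\widehat r(z)+\mathrm i .$$ -/

import Mathlib

open scoped Matrix

noncomputable section

namespace DiracSystem

/-- The matrix `J` of the dynamical Dirac system. -/
def J : Matrix (Fin 2) (Fin 2) ℂ := !![0, 1; -1, 0]

/-- The potential `𝒱(x)` of the dynamical Dirac system. -/
def dynPotential (p q : ℝ → ℝ) (x : ℝ) : Matrix (Fin 2) (Fin 2) ℂ :=
  !![(p x : ℂ), (q x : ℂ); (q x : ℂ), -(p x : ℂ)]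

/-- Boundary controls: continuously differentiable functions on the real line which vanish
for `t ≤ 0` (hence `f(0) = f'(0) = 0`) and are bounded together with their derivative. -/
structure IsControl (f : ℝ → ℂ) : Prop where
  contDiff : ContDiff ℝ 1 f
  eq_zero : ∀ t ≤ 0, f t = 0
  bounded : ∃ c : ℝ, ∀ t, ‖f t‖ ≤ c
  deriv_bounded : ∃ c : ℝ, ∀ t, ‖deriv f t‖ ≤ c

/-- `Y` (the value `Y x t` is the column `Y(x,t)`, with `Y₁ = Y x t 0` and `Y₂ = Y x t 1`) is a
classical solution of `i Y_t + J Y_x + 𝒱 Y = 0` for `x > 0`, `t > 0`, with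
`Y(x,0) = 0` for `x ≥ 0` and `Y₁(0,t) = f(t)` for `t ≥ 0`: it is continuously differentiable
where the equation is imposed and continuous up to the boundary, where the data are imposed. -/
structure IsClassicalSolution (p q : ℝ → ℝ) (f : ℝ → ℂ) (Y : ℝ → ℝ → Fin 2 → ℂ) : Prop where
  continuousOn : ContinuousOn (fun a : ℝ × ℝ => Y a.1 a.2) (Set.Ici 0 ×ˢ Set.Ici 0)
  contDiffOn : ContDiffOn ℝ 1 (fun a : ℝ × ℝ => Y a.1 a.2) (Set.Ioi 0 ×ˢ Set.Ioi 0)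
  equation : ∀ x > 0, ∀ t > 0,
    Complex.I • deriv (fun τ => Y x τ) t + J *ᵥ deriv (fun ξ => Y ξ t) x
      + dynPotential p q x *ᵥ Y x t = 0
  initial : ∀ x ≥ 0, Y x 0 = 0
  boundary : ∀ t ≥ 0, Y 0 t 0 = f t

/-- `r` is the response function: the response operator `R : Y₁(0,·) ↦ Y₂(0,·)` is given by
`R f = i f + r * f`, that is, `Y₂(0,t) = i f(t) + ∫₀ᵗ r(t-s) f(s) ds`. -/
structure IsResponseFunction (p q : ℝ → ℝ) (r : ℝ → ℂ) : Prop where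
  continuousOn : ContinuousOn r (Set.Ici 0)
  response : ∀ f, IsControl f → ∀ Y, IsClassicalSolution p q f Y → ∀ t ≥ 0,
    Y 0 t 1 = Complex.I * f t + ∫ s in (0 : ℝ)..t, r (t - s) * f s

/-- The transform `r̂(z) = ∫₀^∞ e^{izt} r(t) dt`. -/
def hat (r : ℝ → ℂ) (z : ℂ) : ℂ :=
  ∫ t in Set.Ioi (0 : ℝ), Complex.exp (Complex.I * z * t) * r t

/-- The matrix `j = diag(1, -1)`. -/
def j : Matrix (Fin 2) (Fin 2) ℂ := !![1, 0; 0, -1]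

/-- The potential `V(x)` of the spectral Dirac system, with off-diagonal entries `v` and `v̄`. -/
def specPotential (v : ℝ → ℂ) (x : ℝ) : Matrix (Fin 2) (Fin 2) ℂ :=
  !![0, v x; star (v x), 0]

/-- `v = i q - p`: the potential of the spectral Dirac system corresponding to a
dynamical Dirac system. -/
def specOf (p q : ℝ → ℝ) (x : ℝ) : ℂ := Complex.I * q x - p x

/-- `u = u(·,z)` is the fundamental solution on `[0,∞)` of `y' = i (z j + j V) y` normalized by
`u(0,z) = I₂` (the derivative at `0` is one-sided). -/
def IsFundamental (v : ℝ → ℂ) (z : ℂ) (u : ℝ → Matrix (Fin 2) (Fin 2) ℂ) : Prop :=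
  u 0 = 1 ∧ ∀ x ≥ 0, ∀ k l, HasDerivWithinAt (fun s => u s k l)
    ((Complex.I • ((z • j + j * specPotential v x) * u x)) k l) (Set.Ici 0) x

/-- The solution `y = u(·,z) w` with initial value `w` is square summable on `(0,∞)`:
`∫₀^∞ w* u(x,z)* u(x,z) w dx < ∞`. -/
def IsSquareSummable (v : ℝ → ℂ) (z : ℂ) (w : Fin 2 → ℂ) : Prop :=
  ∃ u, IsFundamental v z u ∧
    MeasureTheory.IntegrableOn (fun x => ∑ k, ‖(u x *ᵥ w) k‖ ^ 2) (Set.Ioi (0 : ℝ))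

/-- `φ` is a Weyl function: holomorphic in the upper half-plane, with
`∫₀^∞ [1 φ*] u* u [1; φ] dx < ∞` there. -/
def IsWeylFunction (v : ℝ → ℂ) (φ : ℂ → ℂ) : Prop :=
  DifferentiableOn ℂ φ {z | 0 < z.im} ∧
    ∀ z : ℂ, 0 < z.im → IsSquareSummable v z ![1, φ z]

/-- The matrix `Θ`. -/
def Theta : Matrix (Fin 2) (Fin 2) ℂ := ((1 / √2 : ℝ) : ℂ) • !![1, -1; 1, 1]

/-- `φ_H` is a Herglotz-type Weyl function: holomorphic in the upper half-plane, with
`∫₀^∞ [1 iφ_H*] Θ u* u Θ* [1; -iφ_H] dx < ∞` there. -/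
def IsHerglotzWeylFunction (v : ℝ → ℂ) (φH : ℂ → ℂ) : Prop :=
  DifferentiableOn ℂ φH {z | 0 < z.im} ∧
    ∀ z : ℂ, 0 < z.im → IsSquareSummable v z (Thetaᴴ *ᵥ ![1, -Complex.I * φH z])

end DiracSystem

end

open scoped Matrix

noncomputable section

namespace DiracSystem

open MeasureTheory Set Filter Topology

/-! The same integral representation solves both systems: fed with a control it gives the response
function, fed with the harmonic input `e^{-izt}` it gives the Weyl solution.

In the variables `a = Y₁ + iY₂`, `b = Y₁ - iY₂` the dynamical system becomes `a_x = a_t - α b`, `b_x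
= β a - b_t`, with `α = ip - q` and `β = ip + q`: a left-going and a right-going wave, coupled by
the potential. One seeks `a(x,t) = ∫₀^∞ A(x,τ) f(t-x-τ) dτ` and `b(x,t) = 2f(t-x) + ∫₀^∞ B(x,τ)
f(t-x-τ) dτ`. Integration along characteristics, with `a + b = 2f` at `x = 0`, gives the equations
of `IsKernelPair`. They are solved in a sup norm weighted by `e^{κ(|x|+|τ|)}`, where they are a
contraction once `κ` is at least twice the bound of the potential (`exists_isKernelPair`). Because
the kernels grow at most like `e^{κτ}`, the formulas make sense for every `f` of growth `e^{ρt}`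
with `ρ > κ`, whether or not `f` vanishes for `t ≤ 0` (`isWavePair_conv`).

Testing with controls yields `r = -iA(0,·)` almost everywhere on the half-line (`response_ae_eq`).
For `f = e^{-izt}` the slice `t = 0` gives `y = (b, -a)`, a solution of the spectral system
(`isSpecSolution_of_kernel`) that decays like `e^{-(Im z-κ)x}` and has initial value `(2 - i r̂, -i
r̂)`. The Wronskian of two square summable solutions vanishes (`IsSpecSolution.wronskian_eq_zero`),
so the Weyl solution is proportional to `y`, and both formulas are read off at `x = 0`. That `r̂ +
2i ≠ 0` follows from the monotonicity of `|y₁|² - |y₂|²`. -/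

/-! ### Exponential estimates for integrals from the origin -/

theorem norm_integral_le_exp_mul_abs {g : ℝ → ℂ} {K κ : ℝ} (hκ : 0 < κ) (hK : 0 ≤ K)
    (hg : ∀ s, ‖g s‖ ≤ K * Real.exp (κ * |s|)) (x : ℝ) :
    ‖∫ s in (0 : ℝ)..x, g s‖ ≤ K / κ * Real.exp (κ * |x|) := by
  have pos : ∀ {g : ℝ → ℂ}, (∀ s, ‖g s‖ ≤ K * Real.exp (κ * |s|)) → ∀ {x : ℝ}, 0 ≤ x →
      ‖∫ s in (0 : ℝ)..x, g s‖ ≤ K / κ * Real.exp (κ * |x|) := by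
    intro g hg x hx
    have h := intervalIntegral.norm_integral_le_of_norm_le (μ := volume) (f := g)
      (g := fun s => K * Real.exp (κ * s)) hx
      (ae_of_all _ fun s hs => by simpa [abs_of_pos hs.1] using hg s)
      (Continuous.intervalIntegrable (by fun_prop) _ _)
    refine h.trans ?_
    rw [intervalIntegral.integral_const_mul,
      intervalIntegral.integral_comp_mul_left (fun s => Real.exp s) hκ.ne', integral_exp,
      abs_of_nonneg hx, smul_eq_mul, mul_zero, Real.exp_zero, div_eq_mul_inv, mul_assoc]
    have : 0 ≤ κ⁻¹ := by positivity
    gcongr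
    linarith
  rcases le_total 0 x with hx | hx
  · exact pos hg hx
  · have h := pos (g := fun s => g (-s)) (fun s => by simpa using hg (-s)) (neg_nonneg.2 hx)
    rw [intervalIntegral.integral_comp_neg, neg_neg, neg_zero, intervalIntegral.integral_symm,
      norm_neg, abs_neg] at h
    exact h

theorem norm_integral_le_of_exp_decay {g : ℝ → ℂ} {K κ : ℝ} (hκ : 0 < κ) (hK : 0 ≤ K) {x : ℝ}
    (hg : ∀ s, |s| ≤ |x| → 0 ≤ s * x → ‖g s‖ ≤ K * Real.exp (-κ * |s|)) :
    ‖∫ s in (0 : ℝ)..x, g s‖ ≤ K / κ := by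
  have pos : ∀ {g : ℝ → ℂ} {x : ℝ}, 0 ≤ x →
      (∀ s, |s| ≤ |x| → 0 ≤ s * x → ‖g s‖ ≤ K * Real.exp (-κ * |s|)) →
      ‖∫ s in (0 : ℝ)..x, g s‖ ≤ K / κ := by
    intro g x hx hg
    have h := intervalIntegral.norm_integral_le_of_norm_le (μ := volume) (f := g)
      (g := fun s => K * Real.exp (-κ * s)) hx
      (ae_of_all _ fun s hs => by
        simpa [abs_of_pos hs.1] using hg s (by rw [abs_of_pos hs.1, abs_of_nonneg hx]; exact hs.2)
          (mul_nonneg hs.1.le hx))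
      (Continuous.intervalIntegrable (by fun_prop) _ _)
    refine h.trans ?_
    rw [intervalIntegral.integral_const_mul,
      intervalIntegral.integral_comp_mul_left (fun s => Real.exp s) (neg_ne_zero.2 hκ.ne'),
      integral_exp, smul_eq_mul, mul_zero, Real.exp_zero, div_eq_mul_inv]
    have h1 : 0 < κ⁻¹ := by positivity
    have h2 := Real.exp_pos (-κ * x)
    gcongr
    rw [inv_neg]
    nlinarith
  rcases le_total 0 x with hx | hx
  · exact pos hx hg
  · have h := pos (g := fun s => g (-s)) (neg_nonneg.2 hx) (fun s hs hs' => by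
      simpa using hg (-s) (by simpa using hs) (by linarith))
    rw [intervalIntegral.integral_comp_neg, neg_neg, neg_zero, intervalIntegral.integral_symm,
      norm_neg] at h
    exact h

/-! ### Transport operators in the weighted norm -/

/-- Integration along the right-going characteristics. -/
def rightTransport (β : ℝ → ℂ) (A : ℝ → ℝ → ℂ) (x τ : ℝ) : ℂ :=
  -A 0 τ + ∫ s in (0 : ℝ)..x, β s * A s τ

/-- Integration along the left-going characteristics. -/
def leftTransport (α : ℝ → ℂ) (B : ℝ → ℝ → ℂ) (x τ : ℝ) : ℂ :=
  ∫ s in (0 : ℝ)..τ / 2, α (x + s) * B (x + s) (τ - 2 * s)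

/-- The exponential weight on the plane. -/
def weight (κ x τ : ℝ) : ℝ := Real.exp (κ * (|x| + |τ|))

theorem weight_pos (κ x τ : ℝ) : 0 < weight κ x τ := Real.exp_pos _

theorem one_le_weight {κ : ℝ} (hκ : 0 < κ) (x τ : ℝ) : 1 ≤ weight κ x τ :=
  Real.one_le_exp (by positivity)

theorem weight_eq (κ x τ : ℝ) :
    weight κ x τ = Real.exp (κ * |x|) * Real.exp (κ * |τ|) := by
  rw [weight, mul_add, Real.exp_add]

section Transport

variable {α β : ℝ → ℂ} {A A' B B' : ℝ → ℝ → ℂ} {c κ N : ℝ}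

theorem continuous_rightTransport (hβ : Continuous β)
    (hA : Continuous fun a : ℝ × ℝ => A a.1 a.2) :
    Continuous fun a : ℝ × ℝ => rightTransport β A a.1 a.2 := by
  unfold rightTransport
  refine Continuous.add ?_ ?_
  · exact (hA.comp (by fun_prop : Continuous fun a : ℝ × ℝ => ((0 : ℝ), a.2))).neg
  · apply intervalIntegral.continuous_parametric_intervalIntegral_of_continuous
      (f := fun (a : ℝ × ℝ) s => β s * A s a.2) _ continuous_fst
    exact (hβ.comp continuous_snd).mul
      (hA.comp (by fun_prop : Continuous fun b : (ℝ × ℝ) × ℝ => (b.2, b.1.2)))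

theorem continuous_leftTransport (hα : Continuous α)
    (hB : Continuous fun a : ℝ × ℝ => B a.1 a.2) :
    Continuous fun a : ℝ × ℝ => leftTransport α B a.1 a.2 := by
  unfold leftTransport
  apply intervalIntegral.continuous_parametric_intervalIntegral_of_continuous
    (f := fun (a : ℝ × ℝ) s => α (a.1 + s) * B (a.1 + s) (a.2 - 2 * s)) _
    (by fun_prop : Continuous fun a : ℝ × ℝ => a.2 / 2)
  exact (hα.comp (by fun_prop : Continuous fun b : (ℝ × ℝ) × ℝ => b.1.1 + b.2)).mul
    (hB.comp (by fun_prop :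
      Continuous fun b : (ℝ × ℝ) × ℝ => (b.1.1 + b.2, b.1.2 - 2 * b.2)))

theorem rightTransport_sub (hβ : Continuous β) (hA : Continuous fun a : ℝ × ℝ => A a.1 a.2)
    (hA' : Continuous fun a : ℝ × ℝ => A' a.1 a.2) (x τ : ℝ) :
    rightTransport β A x τ - rightTransport β A' x τ =
      rightTransport β (fun x τ => A x τ - A' x τ) x τ := by
  have h : ∀ {A : ℝ → ℝ → ℂ}, (Continuous fun a : ℝ × ℝ => A a.1 a.2) →
      IntervalIntegrable (fun s => β s * A s τ) volume 0 x := fun hA =>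
    (hβ.mul (hA.comp (by fun_prop : Continuous fun s : ℝ => (s, τ)))).intervalIntegrable _ _
  simp only [rightTransport, mul_sub]
  rw [intervalIntegral.integral_sub (h hA) (h hA')]
  ring

theorem leftTransport_sub (hα : Continuous α) (hB : Continuous fun a : ℝ × ℝ => B a.1 a.2)
    (hB' : Continuous fun a : ℝ × ℝ => B' a.1 a.2) (x τ : ℝ) :
    leftTransport α B x τ - leftTransport α B' x τ =
      leftTransport α (fun x τ => B x τ - B' x τ) x τ := by
  have h : ∀ {B : ℝ → ℝ → ℂ}, (Continuous fun a : ℝ × ℝ => B a.1 a.2) →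
      IntervalIntegrable (fun s => α (x + s) * B (x + s) (τ - 2 * s)) volume 0 (τ / 2) :=
    fun hB => ((hα.comp (by fun_prop : Continuous fun s : ℝ => x + s)).mul (hB.comp
      (by fun_prop : Continuous fun s : ℝ => (x + s, τ - 2 * s)))).intervalIntegrable _ _
  simp only [leftTransport, mul_sub]
  rw [intervalIntegral.integral_sub (h hB) (h hB')]

/-- The boundary term costs a factor `1`; integrating the weight in `x` costs `c / κ ≤ 1/2`. -/
theorem norm_rightTransport_le (hκ : 0 < κ) (hc : 0 ≤ c) (hcκ : 2 * c ≤ κ) (hN : 0 ≤ N)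
    (hβ : ∀ x, ‖β x‖ ≤ c) (hA : ∀ x τ, ‖A x τ‖ ≤ N * weight κ x τ) (x τ : ℝ) :
    ‖rightTransport β A x τ‖ ≤ 3 / 2 * N * weight κ x τ := by
  have h1 : ‖-A 0 τ‖ ≤ N * weight κ x τ := by
    rw [norm_neg]
    refine (hA 0 τ).trans ?_
    refine mul_le_mul_of_nonneg_left (Real.exp_le_exp.2 ?_) hN
    refine mul_le_mul_of_nonneg_left ?_ hκ.le
    simp
  have h2 := norm_integral_le_exp_mul_abs (g := fun s => β s * A s τ)
    (K := c * N * Real.exp (κ * |τ|)) hκ (by positivity) (fun s => by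
      rw [norm_mul]
      calc ‖β s‖ * ‖A s τ‖ ≤ c * (N * weight κ s τ) := by
            gcongr
            exacts [hβ s, hA s τ]
        _ = _ := by rw [weight_eq]; ring) x
  have h3 : c * N * Real.exp (κ * |τ|) / κ * Real.exp (κ * |x|) ≤ 1 / 2 * N * weight κ x τ := by
    have : c / κ ≤ 1 / 2 := by rw [div_le_div_iff₀ hκ two_pos]; linarith
    calc _ = c / κ * N * weight κ x τ := by rw [weight_eq]; ring
      _ ≤ _ := by
        have := weight_pos κ x τ
        gcongr
  calc _ ≤ _ := norm_add_le _ _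
    _ ≤ _ := by linarith

/-- Moving by `s` towards `τ = 0` lowers `|τ|` by `2|s|` and raises `|x|` by at most `|s|`. The
weight thus gains `e^{-κ|s|}`, whose integral gives `c / κ ≤ 1/2`. -/
theorem norm_leftTransport_le (hκ : 0 < κ) (hc : 0 ≤ c) (hcκ : 2 * c ≤ κ) (hN : 0 ≤ N)
    (hα : ∀ x, ‖α x‖ ≤ c) (hB : ∀ x τ, ‖B x τ‖ ≤ N * weight κ x τ) (x τ : ℝ) :
    ‖leftTransport α B x τ‖ ≤ 1 / 2 * N * weight κ x τ := by
  have hw := weight_pos κ x τ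
  have h := norm_integral_le_of_exp_decay (g := fun s => α (x + s) * B (x + s) (τ - 2 * s))
    (x := τ / 2) (K := c * N * weight κ x τ) hκ (by positivity) (fun s hs hs' => by
      rw [norm_mul]
      have key : |x + s| + |τ - 2 * s| ≤ |x| + |τ| - |s| := by
        have h1 := abs_add_le x s
        rw [abs_div, abs_two] at hs
        have h2 : |τ - 2 * s| = |τ| - 2 * |s| := by
          rcases le_total 0 τ with ht | ht
          · rw [abs_of_nonneg ht] at hs ⊢
            rcases ht.eq_or_lt with rfl | ht'
            · have : s = 0 := by simpa using hs
              simp [this]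
            have h0 : 0 ≤ s := by nlinarith
            rw [abs_of_nonneg h0] at hs ⊢
            rw [abs_of_nonneg (by linarith)]
          · rw [abs_of_nonpos ht] at hs ⊢
            rcases ht.eq_or_lt with rfl | ht'
            · have : s = 0 := by simpa using hs
              simp [this]
            have h0 : s ≤ 0 := by nlinarith
            rw [abs_of_nonpos h0] at hs ⊢
            rw [abs_of_nonpos (by linarith)]
            ring
        linarith
      calc _ ≤ c * (N * weight κ (x + s) (τ - 2 * s)) := by
            gcongr
            exacts [hα _, hB _ _]
        _ ≤ c * (N * (weight κ x τ * Real.exp (-κ * |s|))) := by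
            gcongr
            unfold weight
            rw [← Real.exp_add]
            gcongr
            nlinarith
        _ = _ := by ring)
  refine h.trans ?_
  have : c / κ ≤ 1 / 2 := by rw [div_le_div_iff₀ hκ two_pos]; linarith
  calc _ = c / κ * N * weight κ x τ := by ring
    _ ≤ _ := by gcongr

end Transport

/-! ### Existence of the kernels -/

/-- The impulse response of the system in characteristic variables. -/
structure IsKernelPair (α β : ℝ → ℂ) (κ C : ℝ) (A B : ℝ → ℝ → ℂ) : Prop where
  continuous_left : Continuous fun a : ℝ × ℝ => A a.1 a.2
  continuous_right : Continuous fun a : ℝ × ℝ => B a.1 a.2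
  left_le : ∀ x τ, ‖A x τ‖ ≤ C * weight κ x τ
  right_le : ∀ x τ, ‖B x τ‖ ≤ C * weight κ x τ
  left_eq : ∀ x τ, A x τ = α (x + τ / 2) + leftTransport α B x τ
  right_eq : ∀ x τ, B x τ = rightTransport β A x τ

open BoundedContinuousFunction in
-- Eliminating `B` leaves an affine fixed point equation for `A`. Its linear part, left after right
-- transport, has weighted norm at most `1/2 · 3/2 = 3/4`.
theorem exists_isKernelPair {α β : ℝ → ℂ} {c κ : ℝ} (hκ : 0 < κ) (hcκ : 2 * c ≤ κ)
    (hα : Continuous α) (hβ : Continuous β) (hαc : ∀ x, ‖α x‖ ≤ c) (hβc : ∀ x, ‖β x‖ ≤ c) :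
    ∃ A B C, 0 ≤ C ∧ IsKernelPair α β κ C A B := by
  have hc : 0 ≤ c := (norm_nonneg _).trans (hαc 0)
  have hwc : Continuous fun a : ℝ × ℝ => weight κ a.1 a.2 := by
    unfold weight
    fun_prop
  have hwcC : Continuous fun a : ℝ × ℝ => (weight κ a.1 a.2 : ℂ) := by fun_prop
  -- The unknown is `X = A / weight`, so that the weighted norm becomes the ordinary sup norm of a
  -- complete space.
  let up : ((ℝ × ℝ) →ᵇ ℂ) → ℝ → ℝ → ℂ := fun X x τ => weight κ x τ * X (x, τ)
  have hup : ∀ X, Continuous fun a : ℝ × ℝ => up X a.1 a.2 := fun X => hwcC.mul X.continuous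
  have hupn : ∀ X x τ, ‖up X x τ‖ ≤ ‖X‖ * weight κ x τ := fun X x τ => by
    rw [norm_mul, Complex.norm_real, Real.norm_of_nonneg (weight_pos κ x τ).le, mul_comm]
    gcongr
    exacts [(weight_pos κ x τ).le, X.norm_coe_le_norm _]
  let P : ((ℝ × ℝ) →ᵇ ℂ) → ℝ × ℝ → ℂ := fun X a =>
    ((weight κ a.1 a.2)⁻¹ : ℝ) *
      (α (a.1 + a.2 / 2) + leftTransport α (rightTransport β (up X)) a.1 a.2)
  have hPc : ∀ X, Continuous (P X) := fun X => by
    refine Continuous.mul ?_ ?_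
    · exact Complex.continuous_ofReal.comp (hwc.inv₀ fun a => (weight_pos κ _ _).ne')
    · exact (hα.comp (by fun_prop)).add
        (continuous_leftTransport hα (continuous_rightTransport hβ (hup X)))
  have hmul : ∀ (a : ℝ × ℝ) (y : ℂ) (N : ℝ), ‖y‖ ≤ N * weight κ a.1 a.2 →
      ‖(((weight κ a.1 a.2)⁻¹ : ℝ) : ℂ) * y‖ ≤ N := fun a y N h => by
    have hw := weight_pos κ a.1 a.2
    rw [norm_mul, Complex.norm_real, Real.norm_of_nonneg (by positivity), inv_mul_le_iff₀ hw]
    linarith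
  have hPb : ∀ X a, ‖P X a‖ ≤ c + 1 / 2 * (3 / 2 * ‖X‖) := fun X a => by
    apply hmul
    have h1 := one_le_weight hκ a.1 a.2
    have h2 := norm_leftTransport_le hκ hc hcκ (by positivity) hαc
      (norm_rightTransport_le hκ hc hcκ (norm_nonneg X) hβc (hupn X)) a.1 a.2
    have h3 := hαc (a.1 + a.2 / 2)
    have h4 := norm_add_le (α (a.1 + a.2 / 2))
      (leftTransport α (rightTransport β (up X)) a.1 a.2)
    nlinarith
  let Φ : ((ℝ × ℝ) →ᵇ ℂ) → ((ℝ × ℝ) →ᵇ ℂ) := fun X =>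
    BoundedContinuousFunction.ofNormedAddCommGroup (P X) (hPc X) _ (hPb X)
  have hΦ : ContractingWith (3 / 4) Φ := by
    refine ⟨?_, LipschitzWith.of_dist_le_mul fun X Y => ?_⟩
    · rw [← NNReal.coe_lt_coe]; norm_num
    · rw [BoundedContinuousFunction.dist_le (by positivity)]
      intro a
      have e : Φ X a - Φ Y a = ((weight κ a.1 a.2)⁻¹ : ℝ) *
          leftTransport α (rightTransport β (up (X - Y))) a.1 a.2 := by
        change P X a - P Y a = _
        simp only [P]
        rw [← mul_sub, add_sub_add_left_eq_sub, leftTransport_sub hα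
          (continuous_rightTransport hβ (hup X)) (continuous_rightTransport hβ (hup Y))]
        simp_rw [rightTransport_sub hβ (hup X) (hup Y)]
        simp [up, mul_sub]
      rw [dist_eq_norm, dist_eq_norm, e]
      apply hmul
      have h2 := norm_leftTransport_le hκ hc hcκ (by positivity) hαc
        (norm_rightTransport_le hκ hc hcκ (norm_nonneg (X - Y)) hβc (hupn (X - Y))) a.1 a.2
      refine h2.trans (le_of_eq ?_)
      push_cast
      ring
  obtain ⟨X, hX⟩ : ∃ X, Φ X = X := ⟨_, hΦ.fixedPoint_isFixedPt⟩
  refine ⟨up X, rightTransport β (up X), 3 / 2 * ‖X‖, by positivity, hup X,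
    continuous_rightTransport hβ (hup X), fun x τ => (hupn X x τ).trans ?_,
    norm_rightTransport_le hκ hc hcκ (norm_nonneg X) hβc (hupn X), fun x τ => ?_,
    fun x τ => rfl⟩
  · have := weight_pos κ x τ
    gcongr
    linarith [norm_nonneg X]
  · have h : P X (x, τ) = X (x, τ) := congrArg (fun Z : (ℝ × ℝ) →ᵇ ℂ => Z (x, τ)) hX
    have hw : (weight κ x τ : ℂ) ≠ 0 := by exact_mod_cast (weight_pos κ x τ).ne'
    simp only [up]
    rw [← h]
    simp only [P]
    push_cast
    rw [mul_inv_cancel_left₀ hw]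

/-! ### Convolution with exponentially bounded inputs -/

/-- A continuous function of exponential type `ρ` at `±∞`. -/
structure ExpBounded (ρ D : ℝ) (f : ℝ → ℂ) : Prop where
  continuous : Continuous f
  le : ∀ t, ‖f t‖ ≤ D * Real.exp (ρ * t)

/-- A continuous kernel dominated by the exponential weight. -/
structure WeightBounded (κ C : ℝ) (K : ℝ → ℝ → ℂ) : Prop where
  continuous : Continuous fun a : ℝ × ℝ => K a.1 a.2
  le : ∀ x τ, ‖K x τ‖ ≤ C * weight κ x τ

/-- Causal convolution in the second variable. -/
def conv (K : ℝ → ℝ → ℂ) (f : ℝ → ℂ) (x θ : ℝ) : ℂ :=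
  ∫ τ in Ioi (0 : ℝ), K x τ * f (θ - τ)

theorem setIntegral_Ioi_comp_add_left (h : ℝ → ℂ) (x a : ℝ) :
    ∫ s in Ioi a, h (x + s) = ∫ s in Ioi (x + a), h s := by
  have := (measurePreserving_add_left volume x).setIntegral_preimage_emb
    (measurableEmbedding_addLeft x) h (Ioi (x + a))
  simpa using this

theorem hasDerivAt_setIntegral_Ioi {h : ℝ → ℂ} (hc : Continuous h)
    (hi : ∀ a, IntegrableOn h (Ioi a)) (x : ℝ) :
    HasDerivAt (fun x => ∫ s in Ioi x, h s) (-h x) x := by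
  have e : (fun x => ∫ s in Ioi x, h s) =
      fun x => (∫ s in Ioi (0 : ℝ), h s) - ∫ s in (0 : ℝ)..x, h s := by
    funext x
    rw [← intervalIntegral.integral_Ioi_sub_Ioi' (hi 0) (hi x)]
    ring
  rw [e]
  simpa using (hc.integral_hasStrictDerivAt 0 x).hasDerivAt.const_sub _

section Conv

variable {K K' : ℝ → ℝ → ℂ} {f f' : ℝ → ℂ} {κ ρ C C' D D' : ℝ}

theorem WeightBounded.nonneg (hK : WeightBounded κ C K) : 0 ≤ C :=
  nonneg_of_mul_nonneg_left ((norm_nonneg _).trans (hK.le 0 0)) (weight_pos κ 0 0)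

theorem ExpBounded.nonneg (hf : ExpBounded ρ D f) : 0 ≤ D :=
  nonneg_of_mul_nonneg_left ((norm_nonneg _).trans (hf.le 0)) (Real.exp_pos _)

/-- The kernel grows like `e^{κτ}` while `f(θ - τ)` contributes `e^{-ρτ}`; every later integrability
statement rests on the surplus `ρ - κ`. -/
theorem norm_conv_integrand_le (hK : WeightBounded κ C K) (hf : ExpBounded ρ D f) {τ : ℝ}
    (hτ : 0 < τ) (x θ : ℝ) :
    ‖K x τ * f (θ - τ)‖ ≤
      C * D * Real.exp (κ * |x|) * Real.exp (ρ * θ) * Real.exp (-(ρ - κ) * τ) := by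
  have hC := hK.nonneg
  have hD := hf.nonneg
  have hw := weight_pos κ x τ
  rw [norm_mul]
  calc _ ≤ C * weight κ x τ * (D * Real.exp (ρ * (θ - τ))) := by
        gcongr
        exacts [hK.le x τ, hf.le _]
    _ = C * D * (weight κ x τ * Real.exp (ρ * (θ - τ))) := by ring
    _ = _ := by
      rw [weight, abs_of_pos hτ, mul_assoc (C * D), mul_assoc (C * D), ← Real.exp_add,
        ← Real.exp_add, ← Real.exp_add]
      ring_nf

theorem continuous_conv_integrand (hK : WeightBounded κ C K) (hf : ExpBounded ρ D f) :
    Continuous fun a : (ℝ × ℝ) × ℝ => K a.1.1 a.2 * f (a.1.2 - a.2) :=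
  (hK.continuous.comp (by fun_prop : Continuous fun a : (ℝ × ℝ) × ℝ => (a.1.1, a.2))).mul
    (hf.continuous.comp (by fun_prop))

theorem continuous_conv_integrand_slice (hK : WeightBounded κ C K) (hf : ExpBounded ρ D f)
    (x θ : ℝ) : Continuous fun τ => K x τ * f (θ - τ) :=
  (continuous_conv_integrand hK hf).comp (by fun_prop : Continuous fun τ : ℝ => ((x, θ), τ))

theorem aestronglyMeasurable_conv_integrand (hK : WeightBounded κ C K) (hf : ExpBounded ρ D f)
    (x θ : ℝ) : AEStronglyMeasurable (fun τ => K x τ * f (θ - τ)) (volume.restrict (Ioi 0)) :=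
  (continuous_conv_integrand_slice hK hf x θ).aestronglyMeasurable

theorem integrable_exp_decay (hκ : κ < ρ) (c : ℝ) :
    Integrable (fun τ => c * Real.exp (-(ρ - κ) * τ)) (volume.restrict (Ioi 0)) :=
  (exp_neg_integrableOn_Ioi 0 (sub_pos.2 hκ)).const_mul c

theorem integrableOn_conv_integrand (hκ : κ < ρ) (hK : WeightBounded κ C K)
    (hf : ExpBounded ρ D f) (x θ : ℝ) :
    IntegrableOn (fun τ => K x τ * f (θ - τ)) (Ioi 0) :=
  (integrable_exp_decay hκ _).mono' (aestronglyMeasurable_conv_integrand hK hf x θ)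
    ((ae_restrict_iff' measurableSet_Ioi).2 (ae_of_all _ fun _ hτ =>
      norm_conv_integrand_le hK hf hτ x θ))

theorem norm_conv_le (hκ : κ < ρ) (hK : WeightBounded κ C K) (hf : ExpBounded ρ D f)
    (x θ : ℝ) :
    ‖conv K f x θ‖ ≤ C * D / (ρ - κ) * Real.exp (κ * |x|) * Real.exp (ρ * θ) := by
  have h := norm_integral_le_of_norm_le (integrable_exp_decay hκ _)
    ((ae_restrict_iff' measurableSet_Ioi).2 (ae_of_all volume fun _ hτ =>
      norm_conv_integrand_le hK hf hτ x θ))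
  refine h.trans (le_of_eq ?_)
  rw [integral_const_mul, integral_exp_mul_Ioi (by linarith)]
  have : ρ - κ ≠ 0 := (sub_pos.2 hκ).ne'
  simp only [mul_zero, Real.exp_zero]
  field_simp

theorem exists_bound_near (hκ0 : 0 ≤ κ) (hκ : κ < ρ) (x₀ θ₀ : ℝ) :
    ∀ x ∈ Metric.ball x₀ 1, ∀ θ ∈ Metric.ball θ₀ 1,
      Real.exp (κ * |x|) * Real.exp (ρ * θ) ≤
        Real.exp (κ * (|x₀| + 1)) * Real.exp (ρ * (θ₀ + 1)) := by
  intro x hx θ hθ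
  rw [Metric.mem_ball, Real.dist_eq] at hx hθ
  have h1 : |x| ≤ |x₀| + 1 := by
    have := abs_sub_abs_le_abs_sub x x₀
    linarith
  have h2 : θ ≤ θ₀ + 1 := by linarith [(abs_lt.1 hθ).2]
  have : 0 ≤ ρ := hκ0.trans hκ.le
  gcongr

theorem norm_conv_integrand_le_near (hκ0 : 0 ≤ κ) (hκ : κ < ρ) (hK : WeightBounded κ C K)
    (hf : ExpBounded ρ D f) {x₀ θ₀ x θ τ : ℝ} (hx : x ∈ Metric.ball x₀ 1)
    (hθ : θ ∈ Metric.ball θ₀ 1) (hτ : 0 < τ) :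
    ‖K x τ * f (θ - τ)‖ ≤
      C * D * (Real.exp (κ * (|x₀| + 1)) * Real.exp (ρ * (θ₀ + 1))) *
        Real.exp (-(ρ - κ) * τ) := by
  refine (norm_conv_integrand_le hK hf hτ x θ).trans ?_
  have hC := hK.nonneg
  have hD := hf.nonneg
  rw [mul_assoc (C * D)]
  gcongr ?_ * ?_ * ?_
  exact exists_bound_near hκ0 hκ x₀ θ₀ x hx θ hθ

theorem continuous_conv (hκ0 : 0 ≤ κ) (hκ : κ < ρ) (hK : WeightBounded κ C K)
    (hf : ExpBounded ρ D f) : Continuous fun a : ℝ × ℝ => conv K f a.1 a.2 := by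
  rw [continuous_iff_continuousAt]
  rintro ⟨x₀, θ₀⟩
  refine continuousAt_of_dominated (Eventually.of_forall fun a =>
    aestronglyMeasurable_conv_integrand hK hf a.1 a.2) ?_
    (integrable_exp_decay hκ (C * D * (Real.exp (κ * (|x₀| + 1)) * Real.exp (ρ * (θ₀ + 1)))))
    (ae_of_all _ fun τ => ?_)
  · filter_upwards [prod_mem_nhds (Metric.ball_mem_nhds x₀ one_pos)
      (Metric.ball_mem_nhds θ₀ one_pos)] with a ha
    exact (ae_restrict_iff' measurableSet_Ioi).2 (ae_of_all _ fun τ hτ =>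
      norm_conv_integrand_le_near hκ0 hκ hK hf ha.1 ha.2 hτ)
  · exact ((continuous_conv_integrand hK hf).comp
      (by fun_prop : Continuous fun a : ℝ × ℝ => (a, τ))).continuousAt

theorem hasDerivAt_conv_right (hκ0 : 0 ≤ κ) (hκ : κ < ρ) (hK : WeightBounded κ C K)
    (hf : ExpBounded ρ D f) (hf' : ExpBounded ρ D' f') (hff' : ∀ t, HasDerivAt f (f' t) t)
    (x θ : ℝ) : HasDerivAt (fun θ => conv K f x θ) (conv K f' x θ) θ := by
  refine (hasDerivAt_integral_of_dominated_loc_of_deriv_le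
    (F := fun θ τ => K x τ * f (θ - τ)) (F' := fun θ τ => K x τ * f' (θ - τ))
    (Metric.ball_mem_nhds θ one_pos)
    (Eventually.of_forall fun θ => aestronglyMeasurable_conv_integrand hK hf x θ)
    (integrableOn_conv_integrand hκ hK hf x θ)
    (aestronglyMeasurable_conv_integrand hK hf' x θ) ?_ (integrable_exp_decay hκ
      (C * D' * (Real.exp (κ * (|x| + 1)) * Real.exp (ρ * (θ + 1)))))
    (ae_of_all _ fun τ θ _ => ?_)).2
  · exact (ae_restrict_iff' measurableSet_Ioi).2 (ae_of_all _ fun τ hτ θ' hθ' =>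
      norm_conv_integrand_le_near hκ0 hκ hK hf' (Metric.mem_ball_self one_pos) hθ' hτ)
  · exact ((hff' (θ - τ)).comp_sub_const θ τ).const_mul _

theorem hasDerivAt_conv_left (hκ0 : 0 ≤ κ) (hκ : κ < ρ) (hK : WeightBounded κ C K)
    (hK' : WeightBounded κ C' K') (hf : ExpBounded ρ D f)
    (hKK' : ∀ x τ, HasDerivAt (fun x => K x τ) (K' x τ) x) (x θ : ℝ) :
    HasDerivAt (fun x => conv K f x θ) (conv K' f x θ) x := by
  refine (hasDerivAt_integral_of_dominated_loc_of_deriv_le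
    (F := fun x τ => K x τ * f (θ - τ)) (F' := fun x τ => K' x τ * f (θ - τ))
    (Metric.ball_mem_nhds x one_pos)
    (Eventually.of_forall fun x => aestronglyMeasurable_conv_integrand hK hf x θ)
    (integrableOn_conv_integrand hκ hK hf x θ)
    (aestronglyMeasurable_conv_integrand hK' hf x θ) ?_ (integrable_exp_decay hκ
      (C' * D * (Real.exp (κ * (|x| + 1)) * Real.exp (ρ * (θ + 1)))))
    (ae_of_all _ fun τ x _ => ?_)).2
  · exact (ae_restrict_iff' measurableSet_Ioi).2 (ae_of_all _ fun τ hτ x' hx' =>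
      norm_conv_integrand_le_near hκ0 hκ hK' hf hx' (Metric.mem_ball_self one_pos) hτ)
  · exact (hKK' x τ).mul_const _

/-- Interchange of the integration along left-going characteristics with convolution. -/
theorem conv_leftTransport {α : ℝ → ℂ} {c : ℝ} (hκ0 : 0 < κ) (hκ : κ < ρ)
    (hα : Continuous α) (hαc : ∀ x, ‖α x‖ ≤ c) (hK : WeightBounded κ C K)
    (hf : ExpBounded ρ D f) (x θ : ℝ) :
    conv (leftTransport α K) f x θ =
      ∫ s in Ioi (0 : ℝ), α (x + s) * conv K f (x + s) (θ - 2 * s) := by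
  have hC := hK.nonneg
  have hD := hf.nonneg
  have hc : 0 ≤ c := (norm_nonneg _).trans (hαc 0)
  let H : ℝ × ℝ → ℂ := fun a => α (x + a.1) * K (x + a.1) (a.2 - 2 * a.1) * f (θ - a.2)
  have hHc : Continuous H :=
    ((hα.comp (by fun_prop)).mul (hK.continuous.comp (by fun_prop :
      Continuous fun a : ℝ × ℝ => (x + a.1, a.2 - 2 * a.1)))).mul
      (hf.continuous.comp (by fun_prop))
  -- Fubini on the wedge `s ≤ τ/2`, followed by the shift `τ ↦ 2s + τ`. On the wedge `τ - 2s ≥ 0`,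
  -- so the weight supplies the factor `e^{-κs}` needed for integrability in `s`.
  let S : Set (ℝ × ℝ) := {a | a.1 ≤ a.2 / 2}
  have hS : MeasurableSet S :=
    measurableSet_le measurable_fst (measurable_snd.div_const 2)
  have hint : Integrable (S.indicator H)
      ((volume.restrict (Ioi (0 : ℝ))).prod (volume.restrict (Ioi (0 : ℝ)))) := by
    refine Integrable.mono' ((exp_neg_integrableOn_Ioi 0 hκ0).mul_prod
      (integrable_exp_decay hκ (c * C * D * Real.exp (κ * |x|) * Real.exp (ρ * θ))))
      (hHc.aestronglyMeasurable.indicator hS) ?_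
    rw [Measure.prod_restrict, ae_restrict_iff' (measurableSet_Ioi.prod measurableSet_Ioi)]
    refine ae_of_all _ ?_
    rintro ⟨s, τ⟩ ⟨hs, hτ⟩
    simp only [mem_Ioi] at hs hτ
    by_cases hm : (s, τ) ∈ S
    · have hm' : s ≤ τ / 2 := hm
      rw [indicator_of_mem hm]
      simp only [H, norm_mul]
      calc _ ≤ c * (C * weight κ (x + s) (τ - 2 * s)) * (D * Real.exp (ρ * (θ - τ))) := by
            have := weight_pos κ (x + s) (τ - 2 * s)
            gcongr
            exacts [hαc _, hK.le _ _, hf.le _]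
        _ ≤ c * (C * Real.exp (κ * (|x| + s + (τ - 2 * s)))) *
              (D * Real.exp (ρ * (θ - τ))) := by
            unfold weight
            gcongr
            · exact (abs_add_le x s).trans_eq (by rw [abs_of_pos hs])
            · rw [abs_of_nonneg (by linarith)]
        _ = c * C * D * (Real.exp (κ * (|x| + s + (τ - 2 * s))) *
              Real.exp (ρ * (θ - τ))) := by ring
        _ = c * C * D * (Real.exp (-κ * s) * Real.exp (κ * |x|) * Real.exp (ρ * θ) *
              Real.exp (-(ρ - κ) * τ)) := by
            simp only [← Real.exp_add]
            ring_nf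
        _ = _ := by ring
    · rw [indicator_of_notMem hm, norm_zero]
      positivity
  have hL : conv (leftTransport α K) f x θ =
      ∫ τ in Ioi (0 : ℝ), ∫ s in Ioi (0 : ℝ), S.indicator H (s, τ) := by
    refine setIntegral_congr_fun measurableSet_Ioi fun τ hτ => ?_
    simp only [mem_Ioi] at hτ
    have e : (fun s => S.indicator H (s, τ)) = (Iic (τ / 2)).indicator fun s => H (s, τ) := by
      funext s
      simp [indicator, S]
    simp only [e]
    rw [setIntegral_indicator measurableSet_Iic, Ioi_inter_Iic, leftTransport,
      intervalIntegral.integral_of_le (by positivity), ← integral_mul_const]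
  rw [hL, ← integral_integral_swap (f := fun s τ => S.indicator H (s, τ)) hint]
  refine setIntegral_congr_fun measurableSet_Ioi fun s hs => ?_
  simp only [mem_Ioi] at hs
  have e : (fun τ => S.indicator H (s, τ)) = (Ici (2 * s)).indicator fun τ => H (s, τ) := by
    funext τ
    have : s ≤ τ / 2 ↔ 2 * s ≤ τ := by constructor <;> intro h <;> linarith
    simp [indicator, S, this]
  simp only [e]
  rw [setIntegral_indicator measurableSet_Ici, inter_eq_self_of_subset_right
    (Ici_subset_Ioi.2 (by linarith)), integral_Ici_eq_integral_Ioi, conv, ← integral_const_mul,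
    ← add_zero (2 * s), ← setIntegral_Ioi_comp_add_left]
  refine integral_congr_ae (ae_of_all _ fun τ => ?_)
  simp only [H]
  ring_nf

end Conv

/-! ### Joint differentiability from continuous partial derivatives -/

section Partial

variable {f f₁ f₂ : ℝ → ℝ → ℂ}

theorem hasFDerivAt_of_continuous_partials
    (h₁ : ∀ x y, HasDerivAt (fun x => f x y) (f₁ x y) x)
    (h₂ : ∀ x y, HasDerivAt (fun y => f x y) (f₂ x y) y)
    (c₁ : Continuous fun a : ℝ × ℝ => f₁ a.1 a.2) (c₂ : Continuous fun a : ℝ × ℝ => f₂ a.1 a.2)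
    (a : ℝ × ℝ) :
    HasFDerivAt (fun a : ℝ × ℝ => f a.1 a.2)
      ((ContinuousLinearMap.toSpanSingleton ℝ (f₁ a.1 a.2)).coprod
        (ContinuousLinearMap.toSpanSingleton ℝ (f₂ a.1 a.2))) a := by
  have hc : ∀ {g : ℝ → ℝ → ℂ}, (Continuous fun a : ℝ × ℝ => g a.1 a.2) →
      Continuous fun a : ℝ × ℝ => ContinuousLinearMap.toSpanSingleton ℝ (g a.1 a.2) :=
    fun hg => continuous_clm_apply.2 fun y => by
      simp only [ContinuousLinearMap.toSpanSingleton_apply]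
      fun_prop
  exact (hasStrictFDerivAt_uncurry_coprod (𝕜 := ℝ) (f := f)
    (f₁ := fun x y => ContinuousLinearMap.toSpanSingleton ℝ (f₁ x y))
    (f₂ := fun x y => ContinuousLinearMap.toSpanSingleton ℝ (f₂ x y))
    (Eventually.of_forall fun v => (h₁ v.1 v.2).hasFDerivAt)
    (Eventually.of_forall fun v => (h₂ v.1 v.2).hasFDerivAt)
    (hc c₁).continuousAt (hc c₂).continuousAt).hasFDerivAt

theorem contDiff_one_of_continuous_partials
    (h₁ : ∀ x y, HasDerivAt (fun x => f x y) (f₁ x y) x)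
    (h₂ : ∀ x y, HasDerivAt (fun y => f x y) (f₂ x y) y)
    (c₁ : Continuous fun a : ℝ × ℝ => f₁ a.1 a.2)
    (c₂ : Continuous fun a : ℝ × ℝ => f₂ a.1 a.2) :
    ContDiff ℝ 1 fun a : ℝ × ℝ => f a.1 a.2 := by
  refine contDiff_one_iff_hasFDerivAt.2
    ⟨_, continuous_clm_apply.2 fun y => ?_, hasFDerivAt_of_continuous_partials h₁ h₂ c₁ c₂⟩
  simp only [ContinuousLinearMap.coprod_apply, ContinuousLinearMap.toSpanSingleton_apply]
  fun_prop

theorem hasDerivAt_comp_of_continuous_partials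
    (h₁ : ∀ x y, HasDerivAt (fun x => f x y) (f₁ x y) x)
    (h₂ : ∀ x y, HasDerivAt (fun y => f x y) (f₂ x y) y)
    (c₁ : Continuous fun a : ℝ × ℝ => f₁ a.1 a.2) (c₂ : Continuous fun a : ℝ × ℝ => f₂ a.1 a.2)
    {u v : ℝ → ℝ} {u' v' s : ℝ} (hu : HasDerivAt u u' s) (hv : HasDerivAt v v' s) :
    HasDerivAt (fun s => f (u s) (v s)) (u' * f₁ (u s) (v s) + v' * f₂ (u s) (v s)) s := by
  have := (hasFDerivAt_of_continuous_partials h₁ h₂ c₁ c₂ (u s, v s)).comp_hasDerivAt s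
    (hu.prodMk hv)
  simpa [Function.comp_def] using this

end Partial

/-! ### Waves generated by the kernels -/

/-- The right-going component of the solution with boundary data `f`. -/
def rightField (B : ℝ → ℝ → ℂ) (f : ℝ → ℂ) (x θ : ℝ) : ℂ := 2 * f θ + conv B f x θ

theorem setIntegral_Ioi_comp_div_two (g : ℝ → ℂ) :
    ∫ τ in Ioi (0 : ℝ), g (τ / 2) = 2 * ∫ s in Ioi (0 : ℝ), g s := by
  have := integral_comp_mul_left_Ioi g 0 (b := 1 / 2) (by norm_num)
  simp only [mul_zero, one_div, inv_inv, Complex.real_smul, Complex.ofReal_ofNat] at this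
  rw [← this]
  simp [div_eq_inv_mul]

section Field

variable {α β : ℝ → ℂ} {A B : ℝ → ℝ → ℂ} {f f' : ℝ → ℂ} {c κ ρ C D D' : ℝ}

theorem IsKernelPair.weightBounded_left (h : IsKernelPair α β κ C A B) :
    WeightBounded κ C A := ⟨h.continuous_left, h.left_le⟩

theorem IsKernelPair.weightBounded_right (h : IsKernelPair α β κ C A B) :
    WeightBounded κ C B := ⟨h.continuous_right, h.right_le⟩

theorem continuous_rightField (hκ0 : 0 < κ) (hκ : κ < ρ) (hB : WeightBounded κ C B)
    (hf : ExpBounded ρ D f) : Continuous fun a : ℝ × ℝ => rightField B f a.1 a.2 :=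
  (continuous_const.mul (hf.continuous.comp continuous_snd)).add
    (continuous_conv hκ0.le hκ hB hf)

theorem norm_rightField_le (hκ0 : 0 < κ) (hκ : κ < ρ) (hB : WeightBounded κ C B)
    (hf : ExpBounded ρ D f) (x θ : ℝ) :
    ‖rightField B f x θ‖ ≤
      (2 * D + C * D / (ρ - κ)) * Real.exp (κ * |x|) * Real.exp (ρ * θ) := by
  have h1 := norm_conv_le hκ hB hf x θ
  have h2 : ‖2 * f θ‖ ≤ 2 * D * Real.exp (κ * |x|) * Real.exp (ρ * θ) := by
    have h3 : 1 ≤ Real.exp (κ * |x|) := Real.one_le_exp (by positivity)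
    have h4 : 0 ≤ D * Real.exp (ρ * θ) := mul_nonneg hf.nonneg (Real.exp_pos _).le
    rw [norm_mul, Complex.norm_ofNat]
    nlinarith [hf.le θ]
  calc _ ≤ _ := norm_add_le _ _
    _ ≤ _ := add_le_add h2 h1
    _ = _ := by ring

theorem hasDerivAt_rightField_right (hκ0 : 0 < κ) (hκ : κ < ρ) (hB : WeightBounded κ C B)
    (hf : ExpBounded ρ D f) (hf' : ExpBounded ρ D' f') (hff' : ∀ t, HasDerivAt f (f' t) t)
    (x θ : ℝ) : HasDerivAt (fun θ => rightField B f x θ) (rightField B f' x θ) θ :=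
  ((hff' θ).const_mul 2).add (hasDerivAt_conv_right hκ0.le hκ hB hf hf' hff' x θ)

theorem hasDerivAt_rightField_left (hκ0 : 0 < κ) (hκ : κ < ρ) (hβ : Continuous β)
    (hβc : ∀ x, ‖β x‖ ≤ c) (h : IsKernelPair α β κ C A B) (hf : ExpBounded ρ D f) (x θ : ℝ) :
    HasDerivAt (fun x => rightField B f x θ) (β x * conv A f x θ) x := by
  have hK' : WeightBounded κ (c * C) fun x τ => β x * A x τ := by
    refine ⟨(hβ.comp continuous_fst).mul h.continuous_left, fun x τ => ?_⟩
    rw [norm_mul, mul_assoc]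
    exact mul_le_mul (hβc x) (h.left_le x τ) (norm_nonneg _) ((norm_nonneg _).trans (hβc x))
  have hd : ∀ x τ, HasDerivAt (fun x => B x τ) (β x * A x τ) x := fun x τ => by
    have e : (fun x => B x τ) = fun x => -A 0 τ + ∫ s in (0 : ℝ)..x, β s * A s τ := by
      funext x
      exact h.right_eq x τ
    rw [e]
    have hc : Continuous fun s => β s * A s τ :=
      hβ.mul (h.continuous_left.comp (by fun_prop : Continuous fun s : ℝ => (s, τ)))
    exact (hc.integral_hasStrictDerivAt 0 x).hasDerivAt.const_add _
  have := (hasDerivAt_conv_left hκ0.le hκ h.weightBounded_right hK' hf hd x θ).const_add (2 * f θ)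
  have e : β x * conv A f x θ = conv (fun x τ => β x * A x τ) f x θ := by
    simp only [conv, mul_assoc]
    rw [integral_const_mul]
  rw [e]
  exact this

theorem continuous_tail_integrand (hκ0 : 0 < κ) (hκ : κ < ρ) (hα : Continuous α)
    (hB : WeightBounded κ C B) (hf : ExpBounded ρ D f) (η : ℝ) :
    Continuous fun s => α s * rightField B f s (η - 2 * s) :=
  hα.mul ((continuous_rightField hκ0 hκ hB hf).comp
    (by fun_prop : Continuous fun s : ℝ => (s, η - 2 * s)))

theorem integrableOn_tail_integrand (hκ0 : 0 < κ) (hκ : κ < ρ) (hα : Continuous α)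
    (hαc : ∀ x, ‖α x‖ ≤ c) (hB : WeightBounded κ C B) (hf : ExpBounded ρ D f) (η a : ℝ) :
    IntegrableOn (fun s => α s * rightField B f s (η - 2 * s)) (Ioi a) := by
  have hc : 0 ≤ c := (norm_nonneg _).trans (hαc 0)
  have hC := hB.nonneg
  have hD := hf.nonneg
  have hρκ := sub_pos.2 hκ
  refine Integrable.mono' ((exp_neg_integrableOn_Ioi a (by linarith : 0 < 2 * ρ - κ)).const_mul
    (c * (2 * D + C * D / (ρ - κ)) * Real.exp (2 * κ * |a| + ρ * η)))
    (continuous_tail_integrand hκ0 hκ hα hB hf η).aestronglyMeasurable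
    ((ae_restrict_iff' measurableSet_Ioi).2 (ae_of_all _ fun s hs => ?_))
  simp only [mem_Ioi] at hs
  -- The lower limit `a` may be negative; this replaces `|s|` by `s` at the cost of a constant
  -- factor.
  have hs' : |s| ≤ s + 2 * |a| := by
    have h1 := neg_abs_le a
    have h2 := abs_nonneg a
    exact abs_le.2 ⟨by linarith, by linarith⟩
  rw [norm_mul]
  calc _ ≤ c * ((2 * D + C * D / (ρ - κ)) * Real.exp (κ * (s + 2 * |a|)) *
        Real.exp (ρ * (η - 2 * s))) := by
        refine mul_le_mul (hαc s) ((norm_rightField_le hκ0 hκ hB hf s _).trans ?_)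
          (norm_nonneg _) hc
        gcongr
    _ = c * (2 * D + C * D / (ρ - κ)) * (Real.exp (κ * (s + 2 * |a|)) *
        Real.exp (ρ * (η - 2 * s))) := by ring
    _ = _ := by
      rw [mul_assoc _ (Real.exp (2 * κ * |a| + ρ * η)), ← Real.exp_add, ← Real.exp_add]
      ring_nf

/-- The left-going component is generated by the right-going one. -/
theorem conv_left_eq (hκ0 : 0 < κ) (hκ : κ < ρ) (hα : Continuous α) (hαc : ∀ x, ‖α x‖ ≤ c)
    (h : IsKernelPair α β κ C A B) (hf : ExpBounded ρ D f) (x η : ℝ) :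
    conv A f x (η - 2 * x) = ∫ s in Ioi x, α s * rightField B f s (η - 2 * s) := by
  have hc : 0 ≤ c := (norm_nonneg _).trans (hαc 0)
  have hα' : WeightBounded κ c fun x τ => α (x + τ / 2) :=
    ⟨hα.comp (by fun_prop), fun x τ => (hαc _).trans (le_mul_of_one_le_right hc
      (one_le_weight hκ0 x τ))⟩
  have hcl := continuous_leftTransport hα h.continuous_right
  have hl : WeightBounded κ (C + c) (leftTransport α B) := by
    refine ⟨hcl, fun x τ => ?_⟩
    have e : leftTransport α B x τ = A x τ - α (x + τ / 2) := by rw [h.left_eq]; ring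
    rw [e, add_mul]
    exact (norm_sub_le _ _).trans (add_le_add (h.left_le x τ) (hα'.le x τ))
  have e1 : conv A f x (η - 2 * x) =
      conv (fun x τ => α (x + τ / 2)) f x (η - 2 * x) +
        conv (leftTransport α B) f x (η - 2 * x) := by
    unfold conv
    rw [← integral_add (integrableOn_conv_integrand hκ hα' hf _ _)
      (integrableOn_conv_integrand hκ hl hf _ _)]
    simp only [← add_mul, ← h.left_eq]
  have e2 : conv (fun x τ => α (x + τ / 2)) f x (η - 2 * x) =
      ∫ s in Ioi x, α s * (2 * f (η - 2 * s)) := by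
    have := setIntegral_Ioi_comp_div_two fun s => α (x + s) * f (η - 2 * x - 2 * s)
    rw [← integral_const_mul] at this
    have h3 := setIntegral_Ioi_comp_add_left (fun s => α s * (2 * f (η - 2 * s))) x 0
    rw [add_zero] at h3
    rw [← h3]
    refine Eq.trans ?_ (this.trans ?_)
    · refine integral_congr_ae (ae_of_all _ fun s => ?_)
      ring_nf
    · refine integral_congr_ae (ae_of_all _ fun s => ?_)
      ring_nf
  have e3 : conv (leftTransport α B) f x (η - 2 * x) =
      ∫ s in Ioi x, α s * conv B f s (η - 2 * s) := by
    have h3 := setIntegral_Ioi_comp_add_left (fun s => α s * conv B f s (η - 2 * s)) x 0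
    rw [add_zero] at h3
    rw [← h3, conv_leftTransport hκ0 hκ hα hαc h.weightBounded_right hf]
    refine integral_congr_ae (ae_of_all _ fun s => ?_)
    ring_nf
  -- With the zero kernel `rightField` reduces to `2f`, so the tail lemma also covers the direct
  -- term.
  have hzero : WeightBounded κ 0 fun _ _ => (0 : ℂ) := ⟨continuous_const, by simp⟩
  have i0 := integrableOn_tail_integrand hκ0 hκ hα hαc hzero hf η x
  have i1 := integrableOn_tail_integrand hκ0 hκ hα hαc h.weightBounded_right hf η x
  have e0 : (fun s => α s * rightField (fun _ _ => (0 : ℂ)) f s (η - 2 * s)) =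
      fun s => α s * (2 * f (η - 2 * s)) := by simp [rightField, conv]
  rw [e0] at i0
  have i2 : IntegrableOn (fun s => α s * conv B f s (η - 2 * s)) (Ioi x) := by
    refine (i1.sub i0).congr (ae_of_all _ fun s => ?_)
    simp only [Pi.sub_apply, rightField]
    ring
  rw [e1, e2, e3, ← integral_add i0 i2]
  simp only [← mul_add]
  rfl

/-- The kernel `A` contains `α(x + τ/2)` with `α` merely continuous, so it is not differentiated in
`x`. On a characteristic `x + t = η` the wave is a tail integral, and `x` enters only as its lower
limit. -/
theorem hasDerivAt_conv_left_characteristic (hκ0 : 0 < κ) (hκ : κ < ρ) (hα : Continuous α)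
    (hαc : ∀ x, ‖α x‖ ≤ c) (h : IsKernelPair α β κ C A B) (hf : ExpBounded ρ D f) (x η : ℝ) :
    HasDerivAt (fun x => conv A f x (η - 2 * x)) (-(α x * rightField B f x (η - 2 * x))) x := by
  simp_rw [conv_left_eq hκ0 hκ hα hαc h hf]
  exact hasDerivAt_setIntegral_Ioi
    (continuous_tail_integrand hκ0 hκ hα h.weightBounded_right hf η)
    (integrableOn_tail_integrand hκ0 hκ hα hαc h.weightBounded_right hf η) x

/-- A pair of waves `a`, `b` of class `C¹` on the plane that solves the Dirac system in
characteristic variables; `a'`, `b'` are the time derivatives. -/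
structure IsWavePair (α β : ℝ → ℂ) (a a' b b' : ℝ → ℝ → ℂ) : Prop where
  contDiff_left : ContDiff ℝ 1 fun w : ℝ × ℝ => a w.1 w.2
  contDiff_right : ContDiff ℝ 1 fun w : ℝ × ℝ => b w.1 w.2
  left_t : ∀ x t, HasDerivAt (fun t => a x t) (a' x t) t
  right_t : ∀ x t, HasDerivAt (fun t => b x t) (b' x t) t
  left_x : ∀ x t, HasDerivAt (fun x => a x t) (a' x t - α x * b x t) x
  right_x : ∀ x t, HasDerivAt (fun x => b x t) (β x * a x t - b' x t) x

theorem isWavePair_conv (hκ0 : 0 < κ) (hκ : κ < ρ) (hα : Continuous α)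
    (hαc : ∀ x, ‖α x‖ ≤ c) (hβ : Continuous β) (hβc : ∀ x, ‖β x‖ ≤ c)
    (h : IsKernelPair α β κ C A B) (hf : ExpBounded ρ D f) (hf' : ExpBounded ρ D' f')
    (hff' : ∀ t, HasDerivAt f (f' t) t) :
    IsWavePair α β (fun x t => conv A f x (t - x)) (fun x t => conv A f' x (t - x))
      (fun x t => rightField B f x (t - x)) (fun x t => rightField B f' x (t - x)) := by
  have l₁ := hasDerivAt_conv_left_characteristic hκ0 hκ hα hαc h hf
  have l₂ : ∀ x η, HasDerivAt (fun η => conv A f x (η - 2 * x)) (conv A f' x (η - 2 * x)) η :=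
    fun x η => (hasDerivAt_conv_right hκ0.le hκ h.weightBounded_left hf hf' hff' x
      (η - 2 * x)).comp_sub_const η (2 * x)
  have m : Continuous fun w : ℝ × ℝ => (w.1, w.2 - 2 * w.1) := by fun_prop
  have c₁ : Continuous fun w : ℝ × ℝ => -(α w.1 * rightField B f w.1 (w.2 - 2 * w.1)) :=
    ((hα.comp continuous_fst).mul
      ((continuous_rightField hκ0 hκ h.weightBounded_right hf).comp m)).neg
  have c₂ : Continuous fun w : ℝ × ℝ => conv A f' w.1 (w.2 - 2 * w.1) :=
    (continuous_conv hκ0.le hκ h.weightBounded_left hf').comp m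
  have r₁ := hasDerivAt_rightField_left hκ0 hκ hβ hβc h hf
  have r₂ := hasDerivAt_rightField_right hκ0 hκ h.weightBounded_right hf hf' hff'
  have d₁ : Continuous fun w : ℝ × ℝ => β w.1 * conv A f w.1 w.2 :=
    (hβ.comp continuous_fst).mul (continuous_conv hκ0.le hκ h.weightBounded_left hf)
  have d₂ := continuous_rightField hκ0 hκ h.weightBounded_right hf'
  -- The left-going wave is handled in the coordinates `(x, x + t)`, the right-going one in `(x, t -
  -- x)`.
  have el : ∀ x t, conv A f x (t - x) = conv A f x (x + t - 2 * x) := fun x t => by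
    congr 1; ring
  refine ⟨?_, ?_, fun x t => ?_, fun x t => (r₂ x (t - x)).comp_sub_const t x,
    fun x t => ?_, fun x t => ?_⟩
  · have := (contDiff_one_of_continuous_partials
      (f := fun x η => conv A f x (η - 2 * x)) (fun x η => l₁ x η) l₂ c₁ c₂).comp
      (by fun_prop : ContDiff ℝ 1 fun w : ℝ × ℝ => (w.1, w.1 + w.2))
    simp_rw [el]
    exact this
  · exact (contDiff_one_of_continuous_partials r₁ r₂ d₁ d₂).comp
      (by fun_prop : ContDiff ℝ 1 fun w : ℝ × ℝ => (w.1, w.2 - w.1))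
  · exact (hasDerivAt_conv_right hκ0.le hκ h.weightBounded_left hf hf' hff' x
      (t - x)).comp_sub_const t x
  · have := hasDerivAt_comp_of_continuous_partials (s := x)
      (f := fun x η => conv A f x (η - 2 * x)) (fun x η => l₁ x η) l₂ c₁ c₂ (hasDerivAt_id' x)
      ((hasDerivAt_id' x).add_const t)
    simp_rw [el]
    convert this using 1
    rw [Complex.ofReal_one, show x + t - 2 * x = t - x by ring]
    ring
  · have := hasDerivAt_comp_of_continuous_partials (s := x) r₁ r₂ d₁ d₂ (hasDerivAt_id' x)
      ((hasDerivAt_id' x).const_sub t)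
    convert this using 1
    push_cast
    ring

end Field

/-! ### The Dirac coefficients, controls and return to `Y` -/

/-- The coefficient of the left-going wave, continued to the negative half-line. -/
def leftCoeff (p q : ℝ → ℝ) (x : ℝ) : ℂ := Complex.I * p (max x 0) - q (max x 0)

/-- The coefficient of the right-going wave, continued to the negative half-line. -/
def rightCoeff (p q : ℝ → ℝ) (x : ℝ) : ℂ := Complex.I * p (max x 0) + q (max x 0)

theorem continuous_comp_max {p : ℝ → ℝ} (hp : ContinuousOn p (Ici 0)) :
    Continuous fun x => p (max x 0) :=
  hp.comp_continuous (by fun_prop) fun x => le_max_right x 0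

theorem continuous_leftCoeff {p q : ℝ → ℝ} (hp : ContinuousOn p (Ici 0))
    (hq : ContinuousOn q (Ici 0)) : Continuous (leftCoeff p q) :=
  (continuous_const.mul (Complex.continuous_ofReal.comp (continuous_comp_max hp))).sub
    (Complex.continuous_ofReal.comp (continuous_comp_max hq))

theorem continuous_rightCoeff {p q : ℝ → ℝ} (hp : ContinuousOn p (Ici 0))
    (hq : ContinuousOn q (Ici 0)) : Continuous (rightCoeff p q) :=
  (continuous_const.mul (Complex.continuous_ofReal.comp (continuous_comp_max hp))).add
    (Complex.continuous_ofReal.comp (continuous_comp_max hq))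

theorem norm_leftCoeff (p q : ℝ → ℝ) (x : ℝ) :
    ‖leftCoeff p q x‖ = √(p (max x 0) ^ 2 + q (max x 0) ^ 2) := by
  rw [Complex.norm_def, Complex.normSq_apply]
  congr 1
  simp [leftCoeff]
  ring

theorem norm_rightCoeff (p q : ℝ → ℝ) (x : ℝ) :
    ‖rightCoeff p q x‖ = √(p (max x 0) ^ 2 + q (max x 0) ^ 2) := by
  rw [Complex.norm_def, Complex.normSq_apply]
  congr 1
  simp [rightCoeff]
  ring

/-- The first column of the matrix is the image of a unit vector and has this length. -/
theorem sqrt_le_norm_dynPotential (p q : ℝ → ℝ) (x : ℝ) :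
    √(p x ^ 2 + q x ^ 2) ≤ ‖Matrix.toEuclideanCLM (𝕜 := ℂ) (dynPotential p q x)‖ := by
  have h := (Matrix.toEuclideanCLM (𝕜 := ℂ) (dynPotential p q x)).le_opNorm
    (WithLp.toLp 2 ![1, 0])
  have h1 : ‖(WithLp.toLp 2 ![1, 0] : EuclideanSpace ℂ (Fin 2))‖ = 1 := by
    simp [EuclideanSpace.norm_eq]
  rw [h1, mul_one, Matrix.toEuclideanCLM_toLp] at h
  refine le_trans (le_of_eq ?_) h
  simp [EuclideanSpace.norm_eq, dynPotential]

theorem sqrt_le_of_norm_dynPotential_le {p q : ℝ → ℝ} (hp : ContinuousOn p (Ici 0))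
    (hq : ContinuousOn q (Ici 0)) {c : ℝ}
    (h : ∀ x > 0, ‖Matrix.toEuclideanCLM (𝕜 := ℂ) (dynPotential p q x)‖ ≤ c) (x : ℝ) :
    √(p (max x 0) ^ 2 + q (max x 0) ^ 2) ≤ c := by
  have hc : ContinuousOn (fun y => √(p y ^ 2 + q y ^ 2)) (Ici 0) :=
    ((hp.pow 2).add (hq.pow 2)).sqrt
  have hs : Ici (0 : ℝ) ⊆ closure (Ioi 0) := by rw [closure_Ioi]
  exact le_on_closure (s := Ioi (0 : ℝ)) (f := fun y => √(p y ^ 2 + q y ^ 2)) (g := fun _ => c)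
    (fun y hy => (sqrt_le_norm_dynPotential p q y).trans (h y hy))
    (by rw [closure_Ioi]; exact hc) continuousOn_const (hs (le_max_right x 0))

theorem IsControl.expBounded {f : ℝ → ℂ} (hf : IsControl f) {ρ : ℝ} (hρ : 0 < ρ) :
    ∃ D, ExpBounded ρ D f := by
  obtain ⟨c, hc⟩ := hf.bounded
  have hc0 : 0 ≤ c := (norm_nonneg _).trans (hc 0)
  refine ⟨c, hf.contDiff.continuous, fun t => ?_⟩
  rcases le_or_gt t 0 with ht | ht
  · rw [hf.eq_zero t ht, norm_zero]
    positivity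
  · exact (hc t).trans (le_mul_of_one_le_right hc0 (Real.one_le_exp (by positivity)))

theorem IsControl.expBounded_deriv {f : ℝ → ℂ} (hf : IsControl f) {ρ : ℝ} (hρ : 0 < ρ) :
    ∃ D, ExpBounded ρ D (deriv f) := by
  obtain ⟨c, hc⟩ := hf.deriv_bounded
  have hc0 : 0 ≤ c := (norm_nonneg _).trans (hc 0)
  refine ⟨c, hf.contDiff.continuous_deriv le_rfl, fun t => ?_⟩
  rcases lt_or_ge t 0 with ht | ht
  · have : f =ᶠ[𝓝 t] fun _ => 0 := by
      filter_upwards [Iio_mem_nhds ht] with s hs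
      exact hf.eq_zero s (le_of_lt hs)
    rw [this.deriv_eq, deriv_const, norm_zero]
    positivity
  · exact (hc t).trans (le_mul_of_one_le_right hc0 (Real.one_le_exp (by positivity)))

theorem J_mulVec (w : Fin 2 → ℂ) : J *ᵥ w = ![w 1, -w 0] := by
  ext k
  fin_cases k <;> simp [J, Matrix.mulVec, dotProduct, Fin.sum_univ_two]

theorem dynPotential_mulVec (p q : ℝ → ℝ) (x : ℝ) (w : Fin 2 → ℂ) :
    dynPotential p q x *ᵥ w = ![p x * w 0 + q x * w 1, q x * w 0 - p x * w 1] := by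
  ext k
  fin_cases k <;> simp [dynPotential, Matrix.mulVec, dotProduct, Fin.sum_univ_two, sub_eq_add_neg]

/-- The passage from characteristic variables back to the dynamical Dirac system. -/
def ofWaves (a b : ℝ → ℝ → ℂ) (x t : ℝ) : Fin 2 → ℂ :=
  ![(a x t + b x t) / 2, -Complex.I * (a x t - b x t) / 2]

theorem IsWavePair.isClassicalSolution {p q : ℝ → ℝ} {f : ℝ → ℂ} {a a' b b' : ℝ → ℝ → ℂ}
    (h : IsWavePair (leftCoeff p q) (rightCoeff p q) a a' b b')
    (ha : ∀ x ≥ 0, a x 0 = 0) (hb : ∀ x ≥ 0, b x 0 = 0)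
    (hf : ∀ t ≥ 0, a 0 t + b 0 t = 2 * f t) :
    IsClassicalSolution p q f (ofWaves a b) := by
  have hcd : ContDiff ℝ 1 fun w : ℝ × ℝ => ofWaves a b w.1 w.2 := by
    refine contDiff_pi.2 fun k => ?_
    fin_cases k
    · exact (h.contDiff_left.add h.contDiff_right).div_const 2
    · exact (contDiff_const.mul (h.contDiff_left.sub h.contDiff_right)).div_const 2
  have vec : ∀ {u v : ℝ → ℂ} {u' v' : ℂ} {s : ℝ}, HasDerivAt u u' s → HasDerivAt v v' s →
      HasDerivAt (fun s => ![(u s + v s) / 2, -Complex.I * (u s - v s) / 2])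
        ![(u' + v') / 2, -Complex.I * (u' - v') / 2] s := by
    intro u v u' v' s hu hv
    refine hasDerivAt_pi.2 fun k => ?_
    fin_cases k
    · exact (hu.add hv).div_const 2
    · exact ((hu.sub hv).const_mul (-Complex.I)).div_const 2
  refine ⟨hcd.continuous.continuousOn, hcd.contDiffOn, fun x hx t _ => ?_, fun x hx => ?_,
    fun t ht => ?_⟩
  · have ht := (vec (h.left_t x t) (h.right_t x t)).deriv
    have hx' := (vec (h.left_x x t) (h.right_x x t)).deriv
    unfold ofWaves
    rw [ht, hx']
    rw [J_mulVec, dynPotential_mulVec]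
    ext k
    fin_cases k
    · simp [leftCoeff, rightCoeff, max_eq_left hx.le]
      ring_nf
      simp only [Complex.I_sq]
      ring
    · simp [leftCoeff, rightCoeff, max_eq_left hx.le]
      ring_nf
      simp only [Complex.I_sq]
      ring
  · simp [ofWaves, ha x hx, hb x hx]
  · simp [ofWaves, hf t ht]

/-! ### Identification of the response function -/

section Response

variable {A B : ℝ → ℝ → ℂ} {κ C : ℝ}

theorem conv_eq_zero {K : ℝ → ℝ → ℂ} {f : ℝ → ℂ} (hf : ∀ t ≤ 0, f t = 0) (x : ℝ) {θ : ℝ}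
    (hθ : θ ≤ 0) : conv K f x θ = 0 := by
  refine setIntegral_eq_zero_of_forall_eq_zero fun τ hτ => ?_
  simp only [mem_Ioi] at hτ
  rw [hf _ (by linarith), mul_zero]

theorem IsKernelPair.conv_right_zero {α β : ℝ → ℂ} (h : IsKernelPair α β κ C A B) (f : ℝ → ℂ)
    (θ : ℝ) : conv B f 0 θ = -conv A f 0 θ := by
  have : ∀ τ, B 0 τ = -A 0 τ := fun τ => by simp [h.right_eq, rightTransport]
  simp only [conv, this, neg_mul, integral_neg]

/-- The response function is given by the trace of the kernel. -/
theorem response_ae_eq {p q : ℝ → ℝ} (hp : ContinuousOn p (Ici 0)) (hq : ContinuousOn q (Ici 0))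
    {c : ℝ} (hpq : ∀ x, √(p (max x 0) ^ 2 + q (max x 0) ^ 2) ≤ c) (hκ : 0 < κ)
    (h : IsKernelPair (leftCoeff p q) (rightCoeff p q) κ C A B) {r : ℝ → ℂ}
    (hr : IsResponseFunction p q r) :
    ∀ᵐ t, t ∈ Ioi (0 : ℝ) → r t = -Complex.I * A 0 t := by
  have key : ∀ f, IsControl f → ∀ t ≥ 0,
      -Complex.I * conv A f 0 t = ∫ s in (0 : ℝ)..t, r (t - s) * f s := by
    intro f hf t ht
    obtain ⟨D, hD⟩ := hf.expBounded (ρ := κ + 1) (by linarith)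
    obtain ⟨D', hD'⟩ := hf.expBounded_deriv (ρ := κ + 1) (by linarith)
    have hw := isWavePair_conv hκ (by linarith) (continuous_leftCoeff hp hq)
      (fun x => (norm_leftCoeff p q x).trans_le (hpq x)) (continuous_rightCoeff hp hq)
      (fun x => (norm_rightCoeff p q x).trans_le (hpq x)) h hD hD'
      (fun t => (hf.contDiff.differentiable one_ne_zero t).hasDerivAt)
    have hs := hw.isClassicalSolution (f := f)
      (fun x hx => conv_eq_zero hf.eq_zero x (by linarith))
      (fun x hx => by
        rw [rightField, conv_eq_zero hf.eq_zero x (by linarith), hf.eq_zero _ (by linarith)]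
        simp)
      (fun t _ => by
        rw [rightField, h.conv_right_zero, sub_zero]
        ring)
    have := hr.response f hf _ hs t ht
    simp only [ofWaves, rightField, h.conv_right_zero, sub_zero, Matrix.cons_val_one,
      Matrix.cons_val_fin_one] at this
    linear_combination this
  have hA0 : Continuous fun t => A 0 t :=
    h.continuous_left.comp (by fun_prop : Continuous fun t : ℝ => ((0 : ℝ), t))
  have hcont : ContinuousOn (fun t => r t + Complex.I * A 0 t) (Ioi 0) :=
    (hr.continuousOn.mono Ioi_subset_Ici_self).add (continuous_const.mul hA0).continuousOn
  -- It suffices to test against smooth `g` compactly supported in `(0,∞)`.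
  have := isOpen_Ioi.ae_eq_zero_of_integral_contDiff_smul_eq_zero (μ := volume)
    (hcont.locallyIntegrableOn measurableSet_Ioi) fun g hg hgc hgs => ?_
  · filter_upwards [this] with t ht hmem
    linear_combination ht hmem
  obtain ⟨T, hT⟩ := hgc.isCompact.isBounded.bddAbove
  set T' := max T 0 with hT'
  have hg0 : ∀ t ≤ 0, g t = 0 := fun t ht =>
    image_eq_zero_of_notMem_tsupport fun hm => not_lt.2 ht (hgs hm)
  have hgT : ∀ t, T' < t → g t = 0 := fun t ht =>
    image_eq_zero_of_notMem_tsupport fun hm =>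
      not_le.2 ((le_max_left T 0).trans_lt ht) (hT hm)
  -- The reversed function `s ↦ g(S - s)` is a control because `S` lies beyond the support of `g`;
  -- evaluating the convolutions at time `S` turns them into pairings with `g`.
  set S := T' + 1
  have hS : 0 ≤ S := by positivity
  have hgd : ContDiff ℝ 1 fun s => (g (S - s) : ℂ) :=
    Complex.ofRealCLM.contDiff.comp ((hg.of_le (by norm_cast)).comp (by fun_prop))
  have hcs : HasCompactSupport fun s => (g (S - s) : ℂ) := by
    have h1 : HasCompactSupport fun s => g (S - s) :=
      hgc.comp_homeomorph (Homeomorph.subLeft S)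
    exact h1.comp_left (g := fun y : ℝ => (y : ℂ)) Complex.ofReal_zero
  have hctl : IsControl fun s => (g (S - s) : ℂ) := by
    refine ⟨hgd, fun t ht => ?_, ?_, ?_⟩
    · rw [hgT _ (by simp only [S]; linarith), Complex.ofReal_zero]
    · exact hcs.exists_bound_of_continuous hgd.continuous
    · exact hcs.deriv.exists_bound_of_continuous (hgd.continuous_deriv le_rfl)
  have hk := key _ hctl S hS
  have e1 : conv A (fun s => (g (S - s) : ℂ)) 0 S = ∫ t in (0 : ℝ)..S, A 0 t * g t := by
    simp only [conv, sub_sub_cancel]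
    rw [intervalIntegral.integral_of_le hS]
    refine (setIntegral_eq_of_subset_of_forall_sdiff_eq_zero measurableSet_Ioi
      Ioc_subset_Ioi_self fun t ht => ?_)
    rw [hgT t (by
      have := fun h => ht.2 ⟨ht.1, h⟩
      simp only [S] at this
      linarith [not_le.1 this]), Complex.ofReal_zero, mul_zero]
  have e2 : ∫ s in (0 : ℝ)..S, r (S - s) * g (S - s) = ∫ t in (0 : ℝ)..S, r t * g t := by
    rw [intervalIntegral.integral_comp_sub_left (fun t => r t * g t)]
    simp
  rw [e1, e2] at hk
  have e3 : ∫ t, g t • (r t + Complex.I * A 0 t) =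
      ∫ t in (0 : ℝ)..S, (r t * g t + Complex.I * (A 0 t * g t)) := by
    rw [intervalIntegral.integral_of_le hS, ← setIntegral_eq_integral_of_forall_compl_eq_zero
      (s := Ioc 0 S)]
    · refine integral_congr_ae (ae_of_all _ fun t => ?_)
      simp only [Complex.real_smul]
      ring
    · intro t ht
      rcases le_or_gt t 0 with h0 | h0
      · rw [hg0 t h0, zero_smul]
      · rw [hgT t (by
          have := fun h => ht ⟨h0, h⟩
          simp only [S] at this
          linarith [not_le.1 this]), zero_smul]
  have hgC : Continuous fun t => (g t : ℂ) := Complex.continuous_ofReal.comp hg.continuous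
  rw [e3, intervalIntegral.integral_add, intervalIntegral.integral_const_mul]
  · linear_combination -hk
  · refine ContinuousOn.intervalIntegrable (ContinuousOn.mul (hr.continuousOn.mono ?_)
      hgC.continuousOn)
    rw [uIcc_of_le hS]
    exact Icc_subset_Ici_self
  · exact (continuous_const.mul (hA0.mul hgC)).intervalIntegrable _ _

end Response

/-! ### Solutions of the spectral system -/

/-- The two components of a solution of the spectral Dirac system on `[0,∞)`. -/
structure IsSpecSolution (v : ℝ → ℂ) (z : ℂ) (y₁ y₂ : ℝ → ℂ) : Prop where
  left : ∀ x ≥ 0, HasDerivWithinAt y₁ (Complex.I * (z * y₁ x + v x * y₂ x)) (Ici 0) x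
  right : ∀ x ≥ 0,
    HasDerivWithinAt y₂ (-(Complex.I * (z * y₂ x + star (v x) * y₁ x))) (Ici 0) x

theorem IsFundamental.isSpecSolution {v : ℝ → ℂ} {z : ℂ} {u : ℝ → Matrix (Fin 2) (Fin 2) ℂ}
    (hu : IsFundamental v z u) (w : Fin 2 → ℂ) :
    IsSpecSolution v z (fun x => (u x *ᵥ w) 0) (fun x => (u x *ᵥ w) 1) := by
  have e : ∀ k, (fun x => (u x *ᵥ w) k) = fun x => u x k 0 * w 0 + u x k 1 * w 1 := fun k => by
    funext x
    simp [Matrix.mulVec, dotProduct, Fin.sum_univ_two]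
  refine ⟨fun x hx => ?_, fun x hx => ?_⟩
  · have := ((hu.2 x hx 0 0).mul_const (w 0)).add ((hu.2 x hx 0 1).mul_const (w 1))
    rw [e 0]
    refine this.congr_deriv ?_
    simp [j, specPotential, Matrix.vecMul, Matrix.mulVec, dotProduct, Fin.sum_univ_two]
    ring
  · have := ((hu.2 x hx 1 0).mul_const (w 0)).add ((hu.2 x hx 1 1).mul_const (w 1))
    rw [e 1]
    refine this.congr_deriv ?_
    simp [j, specPotential, Matrix.vecMul, Matrix.mulVec, dotProduct, Fin.sum_univ_two]
    ring

section Spectral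

variable {v : ℝ → ℂ} {z : ℂ} {y₁ y₂ w₁ w₂ : ℝ → ℂ}

/-- Square summable solutions are proportional, since their Wronskian is constant. -/
theorem IsSpecSolution.wronskian_eq_zero (hy : IsSpecSolution v z y₁ y₂)
    (hw : IsSpecSolution v z w₁ w₂)
    (hyi : IntegrableOn (fun x => ‖y₁ x‖ ^ 2 + ‖y₂ x‖ ^ 2) (Ioi 0))
    (hwi : IntegrableOn (fun x => ‖w₁ x‖ ^ 2 + ‖w₂ x‖ ^ 2) (Ioi 0)) :
    y₁ 0 * w₂ 0 = y₂ 0 * w₁ 0 := by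
  let W : ℝ → ℂ := fun x => y₁ x * w₂ x - y₂ x * w₁ x
  have hd : ∀ x ∈ Ici (0 : ℝ), HasDerivWithinAt W 0 (Ici 0) x := fun x hx => by
    have := ((hy.left x hx).mul (hw.right x hx)).sub ((hy.right x hx).mul (hw.left x hx))
    refine this.congr_deriv ?_
    ring
  have hconst : ∀ x ∈ Ici (0 : ℝ), W x = W 0 := fun x hx => by
    have := (convex_Ici (0 : ℝ)).norm_image_sub_le_of_norm_hasDerivWithin_le (C := 0)
      hd (fun x _ => by simp) self_mem_Ici hx
    simpa [sub_eq_zero] using this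
  have hi : IntegrableOn (fun _ : ℝ => W 0) (Ioi 0) := by
    refine Integrable.mono' (hyi.add hwi) aestronglyMeasurable_const
      ((ae_restrict_iff' measurableSet_Ioi).2 (ae_of_all _ fun x hx => ?_))
    rw [← hconst x (Ioi_subset_Ici_self hx)]
    have h := norm_sub_le (y₁ x * w₂ x) (y₂ x * w₁ x)
    rw [norm_mul, norm_mul] at h
    simp only [Pi.add_apply]
    nlinarith [sq_nonneg (‖y₁ x‖ - ‖w₂ x‖), sq_nonneg (‖y₂ x‖ - ‖w₁ x‖), sq_nonneg ‖y₁ x‖,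
      sq_nonneg ‖y₂ x‖, sq_nonneg ‖w₁ x‖, sq_nonneg ‖w₂ x‖]
  -- A constant integrable over a half-line of infinite measure is zero.
  rw [integrableOn_const_iff] at hi
  have h0 : W 0 = 0 := by simpa using hi
  exact sub_eq_zero.1 h0

/-- In the upper half-plane `|y₁|² - |y₂|²` decreases along solutions. -/
theorem IsSpecSolution.antitoneOn (hy : IsSpecSolution v z y₁ y₂) (hz : 0 ≤ z.im) :
    AntitoneOn (fun x => ‖y₁ x‖ ^ 2 - ‖y₂ x‖ ^ 2) (Ici 0) := by
  have hd : ∀ x ∈ Ici (0 : ℝ), HasDerivWithinAt (fun x => ‖y₁ x‖ ^ 2 - ‖y₂ x‖ ^ 2)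
      (-2 * z.im * (‖y₁ x‖ ^ 2 + ‖y₂ x‖ ^ 2)) (Ici 0) x := fun x hx => by
    have := (hy.left x hx).norm_sq.sub (hy.right x hx).norm_sq
    refine this.congr_deriv ?_
    simp only [Complex.inner, Complex.sq_norm, Complex.normSq_apply, Complex.mul_re,
      Complex.mul_im, Complex.add_re, Complex.add_im, Complex.neg_re, Complex.neg_im,
      Complex.I_re, Complex.I_im, Complex.conj_re, Complex.conj_im, Complex.star_def]
    ring
  refine antitoneOn_of_deriv_nonpos (convex_Ici 0) (fun x hx => (hd x hx).continuousWithinAt)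
    (fun x hx => ?_) fun x hx => ?_
  · exact (hd x (interior_subset hx)).differentiableWithinAt.mono interior_subset
  · rw [interior_Ici] at hx
    rw [((hd x (Ioi_subset_Ici_self hx)).hasDerivAt (Ici_mem_nhds hx)).deriv]
    have : 0 ≤ z.im * (‖y₁ x‖ ^ 2 + ‖y₂ x‖ ^ 2) := by positivity
    linarith

/-- If `y₁(0) = 0`, monotonicity gives `|y₂(0)|² ≤ |y₂(x)|²` for all `x ≥ 0`, and the right side
tends to zero. -/
theorem IsSpecSolution.eq_zero_of_tendsto (hy : IsSpecSolution v z y₁ y₂) (hz : 0 ≤ z.im)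
    (h : Tendsto y₂ atTop (𝓝 0)) (h0 : y₁ 0 = 0) : y₂ 0 = 0 := by
  have key : ∀ x ≥ 0, ‖y₂ 0‖ ^ 2 ≤ ‖y₂ x‖ ^ 2 := fun x hx => by
    have := hy.antitoneOn hz self_mem_Ici hx hx
    simp only [h0, norm_zero] at this
    nlinarith [sq_nonneg ‖y₁ x‖]
  have ht : Tendsto (fun x => ‖y₂ x‖ ^ 2) atTop (𝓝 0) := by
    simpa using h.norm.pow 2
  have := ge_of_tendsto ht (eventually_ge_atTop (0 : ℝ) |>.mono key)
  simpa using le_antisymm this (sq_nonneg _)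

theorem integrableOn_sq_of_exp_decay {y : ℝ → ℂ} (hy : ContinuousOn y (Ici 0)) {E δ : ℝ}
    (hδ : 0 < δ) (h : ∀ x ≥ 0, ‖y x‖ ≤ E * Real.exp (-δ * x)) :
    IntegrableOn (fun x => ‖y x‖ ^ 2) (Ioi 0) := by
  refine Integrable.mono' ((exp_neg_integrableOn_Ioi 0 (by positivity : 0 < 2 * δ)).const_mul
    (E ^ 2)) (((hy.mono Ioi_subset_Ici_self).norm.pow 2).aestronglyMeasurable measurableSet_Ioi)
    ((ae_restrict_iff' measurableSet_Ioi).2 (ae_of_all _ fun x hx => ?_))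
  rw [Real.norm_of_nonneg (by positivity)]
  calc ‖y x‖ ^ 2 ≤ (E * Real.exp (-δ * x)) ^ 2 := by
        gcongr
        exact h x (le_of_lt hx)
    _ = _ := by
        rw [mul_pow, ← Real.exp_nat_mul]
        push_cast
        ring_nf

theorem tendsto_zero_of_exp_decay {y : ℝ → ℂ} {E δ : ℝ} (hδ : 0 < δ)
    (h : ∀ x ≥ 0, ‖y x‖ ≤ E * Real.exp (-δ * x)) : Tendsto y atTop (𝓝 0) := by
  refine squeeze_zero_norm' (eventually_ge_atTop (0 : ℝ) |>.mono h) ?_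
  have h1 : Tendsto (fun x => -δ * x) atTop atBot :=
    tendsto_id.const_mul_atTop_of_neg (neg_lt_zero.2 hδ)
  simpa using (Real.tendsto_exp_atBot.comp h1).const_mul E

end Spectral

/-! ### Harmonic input and the decaying spectral solution -/

/-- The harmonic control `e^{-izt}`. -/
def harmonicControl (z : ℂ) (t : ℝ) : ℂ := Complex.exp (-(Complex.I * z * t))

theorem norm_harmonic (z : ℂ) (t : ℝ) : ‖harmonicControl z t‖ = Real.exp (z.im * t) := by
  simp [harmonicControl, Complex.norm_exp]

theorem hasDerivAt_harmonic (z : ℂ) (t : ℝ) :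
    HasDerivAt (harmonicControl z) (-(Complex.I * z) * harmonicControl z t) t := by
  have h1 : HasDerivAt (fun t : ℝ => -(Complex.I * z * (t : ℂ))) (-(Complex.I * z)) t := by
    have := ((Complex.ofRealCLM.hasDerivAt (x := t)).const_mul (Complex.I * z)).neg
    exact this.congr_deriv (by simp)
  rw [mul_comm]
  exact h1.cexp

theorem continuous_harmonic (z : ℂ) : Continuous (harmonicControl z) := by
  unfold harmonicControl
  fun_prop

theorem expBounded_harmonic (z : ℂ) : ExpBounded z.im 1 (harmonicControl z) :=
  ⟨continuous_harmonic z, fun t => by rw [norm_harmonic, one_mul]⟩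

theorem expBounded_deriv_harmonic (z : ℂ) :
    ExpBounded z.im ‖z‖ fun t => -(Complex.I * z) * harmonicControl z t :=
  ⟨continuous_const.mul (continuous_harmonic z), fun t => by
    rw [norm_mul, norm_harmonic, norm_neg, norm_mul, Complex.norm_I, one_mul]⟩

theorem conv_const_mul (K : ℝ → ℝ → ℂ) (f : ℝ → ℂ) (c : ℂ) (x θ : ℝ) :
    conv K (fun t => c * f t) x θ = c * conv K f x θ := by
  simp only [conv]
  rw [← integral_const_mul]
  refine integral_congr_ae (ae_of_all _ fun τ => ?_)
  ring

theorem rightField_const_mul (B : ℝ → ℝ → ℂ) (f : ℝ → ℂ) (c : ℂ) (x θ : ℝ) :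
    rightField B (fun t => c * f t) x θ = c * rightField B f x θ := by
  simp only [rightField, conv_const_mul]
  ring

/-- For harmonic input the time derivative is multiplication by `-iz`, so at `t = 0` the wave
equations become ordinary differential equations in `x`; the sign in `-a` matches the convention for
`V`. -/
theorem isSpecSolution_of_kernel {p q : ℝ → ℝ} (hp : ContinuousOn p (Ici 0))
    (hq : ContinuousOn q (Ici 0)) {c : ℝ} (hpq : ∀ x, √(p (max x 0) ^ 2 + q (max x 0) ^ 2) ≤ c)
    {A B : ℝ → ℝ → ℂ} {κ C : ℝ} (hκ : 0 < κ)
    (h : IsKernelPair (leftCoeff p q) (rightCoeff p q) κ C A B) {z : ℂ} (hz : κ < z.im) :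
    IsSpecSolution (specOf p q) z (fun x => rightField B (harmonicControl z) x (0 - x))
      (fun x => -conv A (harmonicControl z) x (0 - x)) := by
  have hw := isWavePair_conv hκ hz (continuous_leftCoeff hp hq)
    (fun x => (norm_leftCoeff p q x).trans_le (hpq x)) (continuous_rightCoeff hp hq)
    (fun x => (norm_rightCoeff p q x).trans_le (hpq x)) h (expBounded_harmonic z)
    (expBounded_deriv_harmonic z) (hasDerivAt_harmonic z)
  refine ⟨fun x hx => ?_, fun x hx => ?_⟩
  · refine (hw.right_x x 0).hasDerivWithinAt.congr_deriv ?_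
    rw [rightField_const_mul, rightCoeff, max_eq_left hx, specOf]
    linear_combination ((q x : ℂ) * conv A (harmonicControl z) x (0 - x)) * Complex.I_sq
  · refine (hw.left_x x 0).neg.hasDerivWithinAt.congr_deriv ?_
    rw [conv_const_mul, leftCoeff, max_eq_left hx, specOf]
    simp only [star_sub, star_mul', Complex.star_def, Complex.conj_I, Complex.conj_ofReal]
    linear_combination (-(q x : ℂ) * rightField B (harmonicControl z) x (0 - x)) * Complex.I_sq

theorem Theta_conjTranspose_mulVec (φ : ℂ) :
    Thetaᴴ *ᵥ ![1, -Complex.I * φ] =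
      ![((1 / √2 : ℝ) : ℂ) * (1 - Complex.I * φ), ((1 / √2 : ℝ) : ℂ) * (-1 - Complex.I * φ)] := by
  ext k
  fin_cases k <;>
    simp [Theta, Matrix.mulVec, dotProduct, Fin.sum_univ_two, Matrix.conjTranspose_apply] <;> ring

end DiracSystem

end

/-! ### The formulas for the Weyl functions -/

theorem mainTheorem10 (p q : ℝ → ℝ)
    (hp : ContDiffOn ℝ 1 p (Set.Ici 0)) (hq : ContDiffOn ℝ 1 q (Set.Ici 0))
    (M₁ : ℝ)
    (hM : ∃ c < M₁, ∀ x > 0,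
      ‖Matrix.toEuclideanCLM (𝕜 := ℂ) (DiracSystem.dynPotential p q x)‖ ≤ c)
    (r : ℝ → ℂ) (hr : DiracSystem.IsResponseFunction p q r)
    (z : ℂ) (hz : 2 * √2 * M₁ < z.im) :
    MeasureTheory.IntegrableOn (fun t : ℝ => Complex.exp (Complex.I * z * t) * r t) (Set.Ioi 0) ∧
    DiracSystem.hat r z + 2 * Complex.I ≠ 0 ∧
    (∀ φ : ℂ → ℂ, DiracSystem.IsWeylFunction (DiracSystem.specOf p q) φ →
      φ z = DiracSystem.hat r z / (DiracSystem.hat r z + 2 * Complex.I)) ∧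
    (∀ φH : ℂ → ℂ, DiracSystem.IsHerglotzWeylFunction (DiracSystem.specOf p q) φH →
      φH z = DiracSystem.hat r z + Complex.I) := by
  open DiracSystem MeasureTheory Set in
  obtain ⟨c, hcM, hc⟩ := hM
  have hpq := sqrt_le_of_norm_dynPotential_le hp.continuousOn hq.continuousOn hc
  have hc0 : 0 ≤ c := (Real.sqrt_nonneg _).trans (hpq 0)
  have hM0 : 0 < M₁ := hc0.trans_lt hcM
  -- The rate `κ = 2M₁` is large enough for the contraction, as `c < M₁`, and lies below `Im z`, as
  -- `√2 ≥ 1`.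
  have hκ : 0 < 2 * M₁ := by positivity
  have hκz : 2 * M₁ < z.im := by
    have : 1 ≤ √2 := Real.one_le_sqrt.2 one_le_two
    nlinarith
  have hz0 : 0 < z.im := hκ.trans hκz
  obtain ⟨A, B, C, -, hk⟩ := exists_isKernelPair hκ (by linarith : 2 * c ≤ 2 * M₁)
    (continuous_leftCoeff hp.continuousOn hq.continuousOn)
    (continuous_rightCoeff hp.continuousOn hq.continuousOn)
    (fun x => (norm_leftCoeff p q x).trans_le (hpq x))
    (fun x => (norm_rightCoeff p q x).trans_le (hpq x))
  have hr' := response_ae_eq hp.continuousOn hq.continuousOn hpq hκ hk hr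
  have hae : (fun t : ℝ => Complex.exp (Complex.I * z * t) * r t) =ᵐ[volume.restrict (Ioi 0)]
      fun t => -Complex.I * (A 0 t * harmonicControl z (0 - t)) := by
    refine (ae_restrict_iff' measurableSet_Ioi).2 (hr'.mono fun t ht hmem => ?_)
    simp only [ht hmem, harmonicControl, zero_sub, Complex.ofReal_neg, mul_neg, neg_neg]
    ring
  have hint := (integrableOn_conv_integrand hκz hk.weightBounded_left (expBounded_harmonic z)
    0 0).const_mul (-Complex.I)
  have hhat : hat r z = -Complex.I * conv A (harmonicControl z) 0 0 := by
    rw [hat, integral_congr_ae hae, integral_const_mul, conv]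
  have hconv : conv A (harmonicControl z) 0 0 = Complex.I * hat r z := by
    rw [hhat]
    linear_combination conv A (harmonicControl z) 0 0 * Complex.I_sq
  have hy := isSpecSolution_of_kernel hp.continuousOn hq.continuousOn hpq hκ hk hκz
  have hy₁0 : rightField B (harmonicControl z) 0 (0 - 0) = 2 - Complex.I * hat r z := by
    rw [rightField, hk.conv_right_zero, sub_zero, hconv]
    simp [harmonicControl]
    ring
  have hy₂0 : -conv A (harmonicControl z) 0 (0 - 0) = -(Complex.I * hat r z) := by
    rw [sub_zero, hconv]
  have hexp : ∀ x ≥ 0, Real.exp (2 * M₁ * |x|) * Real.exp (z.im * (0 - x)) =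
      Real.exp (-(z.im - 2 * M₁) * x) := fun x hx => by
    rw [abs_of_nonneg hx, ← Real.exp_add]
    ring_nf
  obtain ⟨E₁, hb₁⟩ : ∃ E, ∀ x ≥ 0, ‖rightField B (harmonicControl z) x (0 - x)‖ ≤
      E * Real.exp (-(z.im - 2 * M₁) * x) := ⟨_, fun x hx => by
    have := norm_rightField_le hκ hκz hk.weightBounded_right (expBounded_harmonic z) x (0 - x)
    rwa [mul_assoc, hexp x hx] at this⟩
  obtain ⟨E₂, hb₂⟩ : ∃ E, ∀ x ≥ 0, ‖-conv A (harmonicControl z) x (0 - x)‖ ≤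
      E * Real.exp (-(z.im - 2 * M₁) * x) := ⟨_, fun x hx => by
    have := norm_conv_le hκz hk.weightBounded_left (expBounded_harmonic z) x (0 - x)
    rwa [mul_assoc, hexp x hx, ← norm_neg] at this⟩
  have hyi := (integrableOn_sq_of_exp_decay (fun x hx => (hy.left x hx).continuousWithinAt)
    (sub_pos.2 hκz) hb₁).add (integrableOn_sq_of_exp_decay
    (fun x hx => (hy.right x hx).continuousWithinAt) (sub_pos.2 hκz) hb₂)
  -- The vanishing Wronskian at `x = 0`: any square summable initial value is proportional to `(2 -
  -- i r̂, -i r̂)`.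
  have hW : ∀ w, IsSquareSummable (specOf p q) z w →
      (2 - Complex.I * hat r z) * w 1 = -(Complex.I * hat r z) * w 0 := by
    rintro w ⟨u, hu, hui⟩
    have := hy.wronskian_eq_zero (hu.isSpecSolution w) hyi
      (by simpa only [Fin.sum_univ_two] using hui)
    rw [hy₁0, hy₂0] at this
    simpa [hu.1] using this
  -- Otherwise `y₁(0) = 0`, which forces `y₂(0) = 0` by decay, whereas `y₁(0) - y₂(0) = 2`.
  have hne : hat r z + 2 * Complex.I ≠ 0 := by
    intro h0
    have h1 : 2 - Complex.I * hat r z = 0 := by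
      linear_combination (-Complex.I) * h0 + 2 * Complex.I_sq
    have h2 := hy.eq_zero_of_tendsto hz0.le (tendsto_zero_of_exp_decay (sub_pos.2 hκz) hb₂)
      (hy₁0.trans h1)
    rw [hy₂0] at h2
    have : (2 : ℂ) = 0 := by linear_combination h1 - h2
    exact two_ne_zero this
  refine ⟨hint.congr hae.symm, hne, fun φ hφ => ?_, fun φ hφ => ?_⟩
  · have := hW _ (hφ.2 z hz0)
    simp only [Matrix.cons_val_one, Matrix.cons_val_fin_one, Matrix.cons_val_zero] at this
    rw [eq_div_iff hne]
    linear_combination Complex.I * this + (hat r z * φ z - hat r z) * Complex.I_sq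
  · have := hW _ (hφ.2 z hz0)
    rw [Theta_conjTranspose_mulVec] at this
    simp only [Matrix.cons_val_one, Matrix.cons_val_fin_one, Matrix.cons_val_zero] at this
    have h2 : ((1 / √2 : ℝ) : ℂ) ≠ 0 := by
      simp
    have h3 : (2 - Complex.I * hat r z) * (-1 - Complex.I * φ z) =
        -(Complex.I * hat r z) * (1 - Complex.I * φ z) :=
      mul_left_cancel₀ h2 (by linear_combination this)
    linear_combination (Complex.I / 2) * h3 + (φ z - hat r z) * Complex.I_sq
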